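/- Let $k,p,n\ge 1$ be integers with $n>16(k+p)$, let $\nu>0$, $q\in[0,1]$, $R_q>0$, and let $\Sigma\in\mathbb{R}^{p\times p}$ be symmetric positive definite with largest and smallest eigenvalues $\sigma_{\max}(\Sigma)$ and $\sigma_{\min}(\Sigma)$. For $\Theta\in\mathbb{R}^{k\times p}$ let $\sigma_1(\Theta)\ge\dots\ge\sigma_{\min\{k,p\}}(\Theta)\ge 0$ be its singular values, $\|\Theta\|_{*}=\sum_i\sigma_i(\Theta)$ its nuclear norm and $\|\Theta\|_F$ its Frobenius norm, and let $$\mathbb{B}_q(R_q)=\Big\{\Theta\in\mathbb{R}^{k\times p} : \sum_{i=1}^{\min\{k,p\}}\sigma_i(\Theta)^q\le R_q\Big\}\qquad(0^0:=0,\text{ so that for } q=0 \text{ the sum is the rank of } \Theta).$$ Consider the random-design multivariate regression model $Z_a=\Theta^*X_a+W_a$, $a=1,\dots,n$, where $\Theta^*\in\mathbb{B}_q(R_q)$, the covariates $X_a\in\mathbb{R}^p$ are i.i.d. $N(0,\Sigma)$, the noise vectors $W_a\in\mathbb{R}^k$ are i.i.d. $N(0,\nu^2 I_k)$, and the noise is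 independent of the covariates. Put $$\lambda=10\,\nu\,\sqrt{\sigma_{\max}(\Sigma)}\,\sqrt{\frac{k+p}{n}}.$$ There are universal constants $c_1,c_2,c_3>0$ (independent of $k,p,n,q,R_q,\nu,\Sigma,\Theta^*$) such that, with probability greater than $1-c_2\exp(-c_3(k+p))$, every solution $$\widehat\Theta\in\arg\min_{\Theta\in\mathbb{R}^{k\times p}}\Big\{\frac1{2n}\sum_{a=1}^n\|Z_a-\Theta X_a\|_2^2+\lambda\|\Theta\|_{*}\Big\}$$ satisfies $$\|\widehat\Theta-\Theta^*\|_F^2\le c_1\Big(\frac{\nu^2\sigma_{\max}(\Sigma)}{\sigma_{\min}^2(\Sigma)}\Big)^{1-q/2}R_q\Big(\frac{k+p}{n}\Big)^{1-q/2}.$$ -/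

import Mathlib

open MeasureTheory ProbabilityTheory

noncomputable section

namespace LowRank

/-- The linear map `ℝᵖ → ℝᵏ` (Euclidean norms) given by a `k × p` matrix. -/
abbrev toLin {k p : ℕ} (Θ : Matrix (Fin k) (Fin p) ℝ) :
    EuclideanSpace ℝ (Fin p) →ₗ[ℝ] EuclideanSpace ℝ (Fin k) :=
  Matrix.toEuclideanLin Θ

/-- The singular values of a `k × p` matrix in decreasing order; `singularValue Θ 0` is the
largest one, and the indices `i < min k p` enumerate all of them. -/
def singularValue {k p : ℕ} (Θ : Matrix (Fin k) (Fin p) ℝ) (i : ℕ) : ℝ :=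
  (toLin Θ).singularValues i

/-- The nuclear norm: the sum of the `min k p` singular values. -/
def nuclearNorm {k p : ℕ} (Θ : Matrix (Fin k) (Fin p) ℝ) : ℝ :=
  ∑ i ∈ Finset.range (min k p), singularValue Θ i

/-- The squared Frobenius norm. -/
def frobeniusSq {k p : ℕ} (Θ : Matrix (Fin k) (Fin p) ℝ) : ℝ :=
  ∑ i, ∑ j, Θ i j ^ 2

/-- The `ℓ_q`-ball of matrices: `∑ i, σ_i(Θ) ^ q ≤ R`, with the convention `0 ^ 0 = 0`, so that
for `q = 0` the sum is the rank of `Θ`. -/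
def schattenBall (k p : ℕ) (q R : ℝ) : Set (Matrix (Fin k) (Fin p) ℝ) :=
  {Θ | ∑ i ∈ Finset.range (min k p),
      (if singularValue Θ i = 0 then 0 else singularValue Θ i ^ q) ≤ R}

/-- The largest eigenvalue of a symmetric real matrix. -/
def maxEigenvalue {p : ℕ} {S : Matrix (Fin p) (Fin p) ℝ} (hS : S.IsHermitian) : ℝ :=
  ⨆ i, hS.eigenvalues i

/-- The smallest eigenvalue of a symmetric real matrix. -/
def minEigenvalue {p : ℕ} {S : Matrix (Fin p) (Fin p) ℝ} (hS : S.IsHermitian) : ℝ :=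
  ⨅ i, hS.eigenvalues i

/-- The nuclear-norm regularized least-squares objective for the covariate-output pairs
`(x a, z a)`, `a = 1, …, n`, with regularization parameter `lam`. -/
def objective {k p n : ℕ} (x : Fin n → EuclideanSpace ℝ (Fin p))
    (z : Fin n → EuclideanSpace ℝ (Fin k)) (lam : ℝ) (Θ : Matrix (Fin k) (Fin p) ℝ) : ℝ :=
  1 / (2 * (n : ℝ)) * ∑ a, ‖z a - toLin Θ (x a)‖ ^ 2 + lam * nuclearNorm Θ

/-- `Θhat` solves the nuclear-norm regularized least-squares problem over all `k × p` matrices. -/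
def IsSolution {k p n : ℕ} (x : Fin n → EuclideanSpace ℝ (Fin p))
    (z : Fin n → EuclideanSpace ℝ (Fin k)) (lam : ℝ) (Θhat : Matrix (Fin k) (Fin p) ℝ) : Prop :=
  ∀ Θ : Matrix (Fin k) (Fin p) ℝ, objective x z lam Θhat ≤ objective x z lam Θ

/-- The random-design Gaussian multivariate regression model `Z a = Θstar (X a) + W a`: the
covariates `X a` are i.i.d. `N(0, S)`, the noise vectors `W a` are i.i.d. `N(0, ν² I)`, and the
noise is independent of the covariates. -/
structure IsRegressionModel {Ω : Type*} [MeasurableSpace Ω] (P : Measure Ω) {k p n : ℕ}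
    (Θstar : Matrix (Fin k) (Fin p) ℝ) (S : Matrix (Fin p) (Fin p) ℝ) (ν : ℝ)
    (X : Fin n → Ω → EuclideanSpace ℝ (Fin p)) (W Z : Fin n → Ω → EuclideanSpace ℝ (Fin k)) :
    Prop where
  law_covariate : ∀ a, HasLaw (X a) (multivariateGaussian 0 S) P
  law_noise : ∀ a, HasLaw (W a) (multivariateGaussian 0 (ν ^ 2 • (1 : Matrix (Fin k) (Fin k) ℝ))) P
  indep_covariates : iIndepFun X P
  indep_noise : iIndepFun W P
  indep_covariates_noise : IndepFun (fun ω a => X a ω) (fun ω a => W a ω) P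
  output_eq : ∀ a ω, Z a ω = toLin Θstar (X a ω) + W a ω

end LowRank

end

/-! Write D = Θhat − Θstar and N = n⁻¹ ∑ W_a X_aᵀ. Optimality of Θhat against Θstar gives (1/2n) ∑
‖D X_a‖² ≤ ⟨N, D⟩ + λ(‖Θstar‖_* − ‖Θhat‖_*). Everything else is deterministic on an event where ‖N‖
≤ λ/2 in operator norm and n⁻¹ ∑ X_a X_aᵀ has smallest eigenvalue at least κ = σ_min/64. Since n
exceeds a multiple of p, this curvature holds in every direction, so D need not be confined to a
cone.

The right-hand side is bounded by a dual certificate that absorbs the noise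
(`traceInner_add_sum_singularValues_sub_le`). Let u_i, v_i be the singular vectors of Θstar whose
singular values exceed τ, and let P, Q be the projections away from their spans. Then M = ∑ u_i v_iᵀ
+ λ⁻¹ P N Q is a contraction, so ⟨M, Θhat⟩ ≤ ‖Θhat‖_*. In N − λM the part of N off the tangent space
cancels, and the rest has Frobenius norm of order λ √(number of retained values). The discarded
singular values contribute linearly. With τ = λ/κ, membership in the ℓ_q-ball bounds both
contributions by multiples of R τ^(2−q) (`card_mul_sq_add_le_of_mem_schattenBall`,
`IsSolution.frobeniusSq_sub_le`).

The event is likely by Chernoff bounds at fixed directions and a union bound over nets of the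
spheres (`IsRegressionModel.exists_good_event`). The noise is bilinear and is tested on pairs of
directions; the design is whitened first, so that each direction yields standard normal variables.
-/

open MeasureTheory ProbabilityTheory

open scoped InnerProductSpace

namespace LowRank

/-! ### Projections onto and away from finite orthonormal families -/

section Orthonormal

variable {E : Type*} [NormedAddCommGroup E] [InnerProductSpace ℝ E] {ι : Type*} [Fintype ι]

theorem norm_sq_sum_smul_of_orthonormal {u : ι → E} (hu : Orthonormal ℝ u) (a : ι → ℝ) :
    ‖∑ i, a i • u i‖ ^ 2 = ∑ i, a i ^ 2 := by
  rw [← real_inner_self_eq_norm_sq, hu.inner_sum]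
  simp [sq]

theorem inner_sub_sum_of_orthonormal {u : ι → E} (hu : Orthonormal ℝ u) (y : E) (i : ι) :
    ⟪u i, y - ∑ j, ⟪u j, y⟫_ℝ • u j⟫_ℝ = 0 := by
  rw [inner_sub_right, hu.inner_right_fintype, sub_self]

theorem norm_sq_sub_sum_of_orthonormal {u : ι → E} (hu : Orthonormal ℝ u) (y : E) :
    ‖y - ∑ j, ⟪u j, y⟫_ℝ • u j‖ ^ 2 = ‖y‖ ^ 2 - ∑ j, ⟪u j, y⟫_ℝ ^ 2 := by
  rw [norm_sub_sq_real, norm_sq_sum_smul_of_orthonormal hu, inner_sum]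
  simp_rw [inner_smul_right, real_inner_comm _ y, ← sq]
  ring

theorem norm_sub_sum_le_of_orthonormal {u : ι → E} (hu : Orthonormal ℝ u) (y : E) :
    ‖y - ∑ j, ⟪u j, y⟫_ℝ • u j‖ ≤ ‖y‖ := by
  refine le_of_sq_le_sq ?_ (norm_nonneg _)
  rw [norm_sq_sub_sum_of_orthonormal hu]
  have : 0 ≤ ∑ j, ⟪u j, y⟫_ℝ ^ 2 := Finset.sum_nonneg fun _ _ => sq_nonneg _
  linarith

end Orthonormal

/-! ### Singular vectors, nuclear-norm duality and the dual certificate -/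

section TraceInner

variable {E F : Type*} [NormedAddCommGroup E] [InnerProductSpace ℝ E] [FiniteDimensional ℝ E]
  [NormedAddCommGroup F] [InnerProductSpace ℝ F] [FiniteDimensional ℝ F]

/-- The Hilbert–Schmidt inner product of two linear maps. -/
noncomputable def traceInner (A B : E →ₗ[ℝ] F) : ℝ :=
  LinearMap.trace ℝ E (LinearMap.adjoint A ∘ₗ B)

theorem traceInner_eq_sum {ι : Type*} [Fintype ι] (A B : E →ₗ[ℝ] F)
    (b : OrthonormalBasis ι ℝ E) : traceInner A B = ∑ i, ⟪A (b i), B (b i)⟫_ℝ := by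
  rw [traceInner, LinearMap.trace_eq_sum_inner _ b]
  simp [LinearMap.adjoint_inner_right]

theorem traceInner_add_right (A B C : E →ₗ[ℝ] F) :
    traceInner A (B + C) = traceInner A B + traceInner A C := by
  simp [traceInner, LinearMap.comp_add]

/-- An orthonormal basis of right singular vectors. -/
noncomputable def rightSingularBasis {d : ℕ} (hd : Module.finrank ℝ E = d) (T : E →ₗ[ℝ] F) :
    OrthonormalBasis (Fin d) ℝ E :=
  T.isSymmetric_adjoint_comp_self.eigenvectorBasis hd

theorem inner_map_rightSingularBasis {d : ℕ} (hd : Module.finrank ℝ E = d) (T : E →ₗ[ℝ] F)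
    (i j : Fin d) :
    ⟪T (rightSingularBasis hd T i), T (rightSingularBasis hd T j)⟫_ℝ =
      if i = j then T.singularValues i ^ 2 else 0 := by
  rw [← LinearMap.adjoint_inner_right, ← LinearMap.comp_apply, rightSingularBasis,
    LinearMap.IsSymmetric.apply_eigenvectorBasis, T.sq_singularValues_fin hd]
  simp only [RCLike.ofReal_real_eq_id, id_eq, inner_smul_right,
    OrthonormalBasis.inner_eq_ite]
  split_ifs with h
  · simp [h]
  · simp

theorem norm_map_rightSingularBasis {d : ℕ} (hd : Module.finrank ℝ E = d) (T : E →ₗ[ℝ] F)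
    (i : Fin d) : ‖T (rightSingularBasis hd T i)‖ = T.singularValues i := by
  have h := inner_map_rightSingularBasis hd T i i
  rw [if_pos rfl, real_inner_self_eq_norm_sq] at h
  exact (sq_eq_sq₀ (norm_nonneg _) (T.singularValues_nonneg _)).1 h

/-- Duality of operator and nuclear norms: in the right singular basis of `T`, each diagonal term is
at most ‖T v_i‖ = σ_i by Cauchy–Schwarz. -/
theorem traceInner_le_sum_singularValues {d : ℕ} (hd : Module.finrank ℝ E = d)
    (M T : E →ₗ[ℝ] F) (hM : ∀ x, ‖M x‖ ≤ ‖x‖) :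
    traceInner M T ≤ ∑ i : Fin d, T.singularValues i := by
  rw [traceInner_eq_sum M T (rightSingularBasis hd T)]
  refine Finset.sum_le_sum fun i _ => (real_inner_le_norm _ _).trans ?_
  rw [norm_map_rightSingularBasis]
  have := hM (rightSingularBasis hd T i)
  rw [OrthonormalBasis.norm_eq_one] at this
  exact mul_le_of_le_one_left (T.singularValues_nonneg _) this

theorem sum_inner_le_sqrt_card_mul {ι : Type*} [Fintype ι] (D : E →ₗ[ℝ] F)
    (b : OrthonormalBasis ι ℝ E) (s : Finset ι) (w : ι → F) {c : ℝ} (hc : 0 ≤ c)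
    (hw : ∀ i ∈ s, ‖w i‖ ≤ c) :
    ∑ i ∈ s, ⟪w i, D (b i)⟫_ℝ ≤ c * √s.card * √(traceInner D D) := by
  calc ∑ i ∈ s, ⟪w i, D (b i)⟫_ℝ ≤ ∑ i ∈ s, c * ‖D (b i)‖ := by
        refine Finset.sum_le_sum fun i hi => (real_inner_le_norm _ _).trans ?_
        exact mul_le_mul_of_nonneg_right (hw i hi) (norm_nonneg _)
    _ ≤ √(∑ i ∈ s, c ^ 2) * √(∑ i ∈ s, ‖D (b i)‖ ^ 2) := Real.sum_mul_le_sqrt_mul_sqrt _ _ _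
    _ ≤ c * √s.card * √(traceInner D D) := by
        rw [Finset.sum_const, nsmul_eq_mul, mul_comm _ (c ^ 2), Real.sqrt_mul (sq_nonneg _),
          Real.sqrt_sq hc, traceInner_eq_sum D D b]
        gcongr
        simp_rw [real_inner_self_eq_norm_sq]
        exact Finset.sum_le_sum_of_subset_of_nonneg (Finset.subset_univ _)
          fun _ _ _ => sq_nonneg _

theorem orthonormal_leftSingularVectors {d : ℕ} (hd : Module.finrank ℝ E = d) (T : E →ₗ[ℝ] F)
    (s : Finset (Fin d)) (hs : ∀ i ∈ s, 0 < T.singularValues i) :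
    Orthonormal ℝ fun i : s => (T.singularValues i)⁻¹ • T (rightSingularBasis hd T i) := by
  classical
  rw [orthonormal_iff_ite]
  rintro ⟨i, hi⟩ ⟨j, hj⟩
  have := hs i hi
  simp only [inner_smul_left, inner_smul_right, inner_map_rightSingularBasis, Subtype.mk.injEq]
  split_ifs with h
  · subst h
    simp
    field_simp
  · simp

/-- Subgradient bound for the nuclear norm at `T`, with a certificate built from `N`. -/
theorem traceInner_add_sum_singularValues_sub_le {d : ℕ} (hd : Module.finrank ℝ E = d)
    (T D N : E →ₗ[ℝ] F) {l : ℝ} (hl : 0 < l) (hN : ∀ x, ‖N x‖ ≤ l / 2 * ‖x‖)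
    (s : Finset (Fin d)) (hs : ∀ i ∈ s, 0 < T.singularValues i) :
    traceInner N D + l * (∑ i : Fin d, T.singularValues i - ∑ i : Fin d, (T + D).singularValues i)
      ≤ 2 * l * √s.card * √(traceInner D D) + 3 / 2 * l * ∑ i ∈ sᶜ, T.singularValues i := by
  classical
  set v := rightSingularBasis hd T with hv
  set u : s → F := fun i => (T.singularValues i)⁻¹ • T (v i) with hu
  have hu_on : Orthonormal ℝ u := orthonormal_leftSingularVectors hd T s hs
  have hv_on : Orthonormal ℝ (fun i : s => v i) := v.orthonormal.comp _ Subtype.val_injective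
  let U : E →ₗ[ℝ] F := ∑ i : s, (innerₛₗ ℝ (v i)).smulRight (u i)
  let P : F →ₗ[ℝ] F := LinearMap.id - ∑ i : s, (innerₛₗ ℝ (u i)).smulRight (u i)
  let Q : E →ₗ[ℝ] E := LinearMap.id - ∑ i : s, (innerₛₗ ℝ (v i)).smulRight (v i)
  have hU x : U x = ∑ i : s, ⟪v i, x⟫_ℝ • u i := by simp [U]
  have hP y : P y = y - ∑ i : s, ⟪u i, y⟫_ℝ • u i := by simp [P]
  have hQ x : Q x = x - ∑ i : s, ⟪v i, x⟫_ℝ • v i := by simp [Q]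
  -- The two summands have orthogonal ranges and see orthogonal parts of the input, so `M` is a
  -- contraction as soon as the second one is. The choice l⁻¹ N makes l • M cancel `N` off the
  -- tangent space.
  let M : E →ₗ[ℝ] F := U + l⁻¹ • (P ∘ₗ N ∘ₗ Q)
  have hM x : M x = U x + l⁻¹ • P (N (Q x)) := by simp [M]
  have hPnorm y : ‖P y‖ ≤ ‖y‖ := by rw [hP]; exact norm_sub_sum_le_of_orthonormal hu_on y
  have hMnorm x : ‖M x‖ ≤ ‖x‖ := by
    refine le_of_sq_le_sq ?_ (norm_nonneg _)
    have horth : ⟪U x, l⁻¹ • P (N (Q x))⟫_ℝ = 0 := by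
      rw [hU, inner_smul_right, sum_inner]
      simp_rw [inner_smul_left, hP, inner_sub_sum_of_orthonormal hu_on]
      simp
    rw [hM, norm_add_sq_real, horth, hU, norm_sq_sum_smul_of_orthonormal hu_on]
    have h1 : ‖l⁻¹ • P (N (Q x))‖ ≤ ‖Q x‖ := by
      rw [norm_smul, Real.norm_of_nonneg (inv_nonneg.2 hl.le), inv_mul_le_iff₀ hl]
      refine (hPnorm _).trans ((hN _).trans ?_)
      gcongr
      linarith
    have h2 := pow_le_pow_left₀ (norm_nonneg _) h1 2
    have h3 := norm_sq_sub_sum_of_orthonormal hv_on x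
    rw [← hQ] at h3
    linarith
  have hPmem (i : s) : P (u i) = 0 := by
    rw [hP]
    simp [orthonormal_iff_ite.1 hu_on]
  have hQmem i (hi : i ∈ s) : Q (v i) = 0 := by
    rw [hQ, Finset.sum_eq_single ⟨i, hi⟩]
    · simp
    · rintro ⟨j, hj⟩ - hne
      have : j ≠ i := fun h => hne (Subtype.ext h)
      simp [this]
    · simp
  have hMmem i (hi : i ∈ s) : M (v i) = u ⟨i, hi⟩ := by
    rw [hM, hQmem i hi, hU, Finset.sum_eq_single ⟨i, hi⟩]
    · simp
    · rintro ⟨j, hj⟩ - hne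
      have : j ≠ i := fun h => hne (Subtype.ext h)
      simp [this]
    · simp
  have hzero i (hi : i ∈ sᶜ) (j : s) : ⟪v j, v i⟫_ℝ = 0 := by
    rw [OrthonormalBasis.inner_eq_ite, if_neg]
    rintro rfl
    exact Finset.mem_compl.1 hi j.2
  have hMcompl i (hi : i ∈ sᶜ) : M (v i) = l⁻¹ • P (N (v i)) := by
    rw [hM, hU, hQ]
    simp [hzero i hi]
  have hNv i : ‖N (v i)‖ ≤ l / 2 := by simpa using hN (v i)
  -- the certificate against `T`
  have hMT : ∑ i ∈ s, T.singularValues i - 1 / 2 * ∑ i ∈ sᶜ, T.singularValues i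
      ≤ traceInner M T := by
    rw [traceInner_eq_sum M T v, ← Finset.sum_add_sum_compl s, Finset.mul_sum, sub_eq_add_neg,
      ← Finset.sum_neg_distrib]
    refine add_le_add (Finset.sum_le_sum fun i hi => ?_) (Finset.sum_le_sum fun i hi => ?_)
    · rw [hMmem i hi, hu]
      simp only [inner_smul_left, real_inner_self_eq_norm_sq, hv, norm_map_rightSingularBasis]
      have := hs i hi
      simp only [conj_trivial]
      field_simp
      exact le_refl _
    · rw [hMcompl i hi]
      have h1 : ‖l⁻¹ • P (N (v i))‖ ≤ 1 / 2 := by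
        rw [norm_smul, Real.norm_of_nonneg (inv_nonneg.2 hl.le), inv_mul_le_iff₀ hl]
        refine (hPnorm _).trans ((hNv i).trans ?_)
        linarith
      have h2 := (abs_le.1 (abs_real_inner_le_norm (l⁻¹ • P (N (v i))) (T (v i)))).1
      rw [hv, norm_map_rightSingularBasis, ← hv] at h2
      have h3 := mul_le_mul_of_nonneg_right h1 (T.singularValues_nonneg i)
      linarith
  -- the certificate against `D`
  have hMD : traceInner N D - l * traceInner M D ≤ 2 * l * √s.card * √(traceInner D D) := by
    -- On `s` the vector N v_i − l M v_i has norm at most l/2 + l. Off `s` it is N v_i − P N v_i,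
    -- the projection of N v_i onto the span of the `u j`.
    have hsplit : traceInner N D - l * traceInner M D =
        ∑ i ∈ s, ⟪N (v i) - l • M (v i), D (v i)⟫_ℝ +
        ∑ i ∈ sᶜ, ∑ j : s, ⟪u j, N (v i)⟫_ℝ * ⟪u j, D (v i)⟫_ℝ := by
      rw [traceInner_eq_sum M D v, traceInner_eq_sum N D v, Finset.mul_sum,
        ← Finset.sum_sub_distrib, ← Finset.sum_add_sum_compl s]
      congr 1
      · refine Finset.sum_congr rfl fun i _ => ?_
        simp [inner_sub_left, inner_smul_left]
      · refine Finset.sum_congr rfl fun i hi => ?_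
        rw [hMcompl i hi, hP, inner_smul_left, inner_sub_left, sum_inner]
        simp only [conj_trivial, inner_smul_left]
        field_simp
        ring
    have hfirst : ∑ i ∈ s, ⟪N (v i) - l • M (v i), D (v i)⟫_ℝ ≤
        (3 / 2 * l) * √s.card * √(traceInner D D) := by
      refine sum_inner_le_sqrt_card_mul D v s _ (by positivity) fun i hi => ?_
      refine (norm_sub_le _ _).trans ?_
      rw [norm_smul, Real.norm_of_nonneg hl.le]
      have := hMnorm (v i)
      rw [OrthonormalBasis.norm_eq_one] at this
      nlinarith [hNv i]
    have hsecond : ∑ i ∈ sᶜ, ∑ j : s, ⟪u j, N (v i)⟫_ℝ * ⟪u j, D (v i)⟫_ℝ ≤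
        (1 / 2 * l) * √s.card * √(traceInner D D) := by
      rw [← Finset.sum_product']
      refine (Real.sum_mul_le_sqrt_mul_sqrt _ _ _).trans ?_
      refine mul_le_mul ?_ ?_ (Real.sqrt_nonneg _) (by positivity)
      · have : (1 / 2 * l) * √s.card = √(s.card * (l / 2) ^ 2) := by
          rw [Real.sqrt_mul (by positivity), Real.sqrt_sq (by positivity)]
          ring
        rw [this]
        refine Real.sqrt_le_sqrt ?_
        rw [Finset.sum_product_right]
        -- The sum is part of ‖Nᵀ u_j‖², and the adjoint inherits the operator bound l/2. Summing
        -- over `j` gives √card · l/2, with no dimension factor.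
        have hcol (j : s) : ∑ i ∈ sᶜ, ⟪u j, N (v i)⟫_ℝ ^ 2 ≤ (l / 2) ^ 2 := by
          calc ∑ i ∈ sᶜ, ⟪u j, N (v i)⟫_ℝ ^ 2
              ≤ ∑ i, ⟪u j, N (v i)⟫_ℝ ^ 2 :=
                Finset.sum_le_sum_of_subset_of_nonneg (Finset.subset_univ _)
                  fun _ _ _ => sq_nonneg _
            _ = ‖LinearMap.adjoint N (u j)‖ ^ 2 := by
                rw [← v.sum_sq_inner_left]
                simp [LinearMap.adjoint_inner_left]
            _ ≤ (l / 2) ^ 2 := by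
                refine pow_le_pow_left₀ (norm_nonneg _) ?_ 2
                set y := LinearMap.adjoint N (u j) with hy
                have h1 : ‖y‖ ^ 2 ≤ l / 2 * ‖y‖ := by
                  rw [← real_inner_self_eq_norm_sq, hy, LinearMap.adjoint_inner_left, ← hy]
                  refine (real_inner_le_norm _ _).trans ?_
                  rw [hu_on.1 j, one_mul]
                  exact hN y
                by_contra! h
                nlinarith [norm_nonneg y]
        calc _ ≤ ∑ j : s, (l / 2) ^ 2 := Finset.sum_le_sum fun j _ => hcol j
          _ = _ := by simp
      · refine Real.sqrt_le_sqrt ?_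
        rw [Finset.sum_product, traceInner_eq_sum D D v]
        calc ∑ i ∈ sᶜ, ∑ j : s, ⟪u j, D (v i)⟫_ℝ ^ 2
            ≤ ∑ i ∈ sᶜ, ⟪D (v i), D (v i)⟫_ℝ := Finset.sum_le_sum fun i _ => by
              have := norm_sq_sub_sum_of_orthonormal hu_on (D (v i))
              rw [real_inner_self_eq_norm_sq]
              nlinarith [sq_nonneg ‖D (v i) - ∑ j, ⟪u j, D (v i)⟫_ℝ • u j‖]
          _ ≤ _ := Finset.sum_le_sum_of_subset_of_nonneg (Finset.subset_univ _)
                fun _ _ _ => real_inner_self_nonneg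
    rw [hsplit]
    linarith
  have hdual := traceInner_le_sum_singularValues hd M (T + D) hMnorm
  rw [traceInner_add_right] at hdual
  have hsum := Finset.sum_add_sum_compl s fun i => T.singularValues (i : ℕ)
  rw [← hsum]
  have h1 := mul_le_mul_of_nonneg_left hdual hl.le
  have h2 := mul_le_mul_of_nonneg_left hMT hl.le
  linarith

end TraceInner

/-! ### Nets of the sphere and lower bounds for linear maps -/

section Net

open Metric Module
open scoped ENNReal Function

variable {E : Type*} [NormedAddCommGroup E] [NormedSpace ℝ E] [FiniteDimensional ℝ E]

/-- Volumetric bound on the size of a `δ`-separated set in the unit ball. -/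
theorem card_le_of_separated_unitBall (s : Finset E) {δ : ℝ} (hδ : 0 < δ)
    (hs : ∀ c ∈ s, ‖c‖ ≤ 1) (h : ∀ c ∈ s, ∀ d ∈ s, c ≠ d → δ ≤ ‖c - d‖) :
    (s.card : ℝ) ≤ (1 + 2 / δ) ^ finrank ℝ E := by
  borelize E
  let μ : Measure E := Measure.addHaar
  let ρ : ℝ := 1 + δ / 2
  have hρ : 0 < ρ := by positivity
  have hδ2 : 0 < δ / 2 := by positivity
  -- Volume packing: disjoint balls of radius δ/2 inside the ball of radius 1 + δ/2.
  have hdisj : Set.Pairwise (s : Set E) (Disjoint on fun c => ball (c : E) (δ / 2)) := by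
    rintro c hc d hd hcd
    apply ball_disjoint_ball
    rw [dist_eq_norm, add_halves]
    exact h c hc d hd hcd
  have hsub : (⋃ c ∈ s, ball (c : E) (δ / 2)) ⊆ ball (0 : E) ρ := by
    refine Set.iUnion₂_subset fun x hx => ball_subset_ball' ?_
    rw [dist_zero_right]
    have := hs x hx
    simp only [ρ]
    linarith
  have hvol : (s.card : ℝ≥0∞) * ENNReal.ofReal ((δ / 2) ^ finrank ℝ E) * μ (ball 0 1) ≤
      ENNReal.ofReal (ρ ^ finrank ℝ E) * μ (ball 0 1) :=
    calc
      (s.card : ℝ≥0∞) * ENNReal.ofReal ((δ / 2) ^ finrank ℝ E) * μ (ball 0 1)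
          = μ (⋃ c ∈ s, ball (c : E) (δ / 2)) := by
        rw [measure_biUnion_finset hdisj fun c _ => measurableSet_ball]
        simp only [μ.addHaar_ball_of_pos _ hδ2]
        simp only [Finset.sum_const, nsmul_eq_mul, mul_assoc]
      _ ≤ μ (ball (0 : E) ρ) := measure_mono hsub
      _ = ENNReal.ofReal (ρ ^ finrank ℝ E) * μ (ball 0 1) := by
        simp only [μ.addHaar_ball_of_pos _ hρ]
  have hcard : (s.card : ℝ≥0∞) * ENNReal.ofReal ((δ / 2) ^ finrank ℝ E) ≤
      ENNReal.ofReal (ρ ^ finrank ℝ E) :=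
    (ENNReal.mul_le_mul_iff_left (measure_ball_pos _ _ zero_lt_one).ne' measure_ball_lt_top.ne).1
      hvol
  have hreal := ENNReal.toReal_le_of_le_ofReal (pow_nonneg hρ.le _) hcard
  rw [ENNReal.toReal_mul, ENNReal.toReal_natCast, ENNReal.toReal_ofReal (by positivity)] at hreal
  have : 1 + 2 / δ = ρ / (δ / 2) := by simp only [ρ]; field_simp; ring
  rw [this, div_pow, le_div_iff₀ (by positivity)]
  exact hreal

/-- The unit sphere has a `δ`-net with at most `(1 + 2 / δ) ^ d` points. -/
theorem exists_sphere_net {δ : ℝ} (hδ : 0 < δ) :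
    ∃ s : Finset E, (∀ c ∈ s, ‖c‖ = 1) ∧ (s.card : ℝ) ≤ (1 + 2 / δ) ^ finrank ℝ E ∧
      ∀ x : E, ‖x‖ = 1 → ∃ c ∈ s, ‖x - c‖ < δ := by
  classical
  let Good : Finset E → Prop := fun s =>
    (∀ c ∈ s, ‖c‖ = 1) ∧ ∀ c ∈ s, ∀ d ∈ s, c ≠ d → δ ≤ ‖c - d‖
  have hbound (s : Finset E) (hs : Good s) : (s.card : ℝ) ≤ (1 + 2 / δ) ^ finrank ℝ E :=
    card_le_of_separated_unitBall s hδ (fun c hc => (hs.1 c hc).le) hs.2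
  let A : Set ℕ := {m | ∃ s, Good s ∧ s.card = m}
  have hbdd : BddAbove A := by
    refine ⟨⌈(1 + 2 / δ) ^ finrank ℝ E⌉₊, ?_⟩
    rintro _ ⟨s, hs, rfl⟩
    exact_mod_cast (hbound s hs).trans (Nat.le_ceil _)
  -- A separated set of largest cardinality is a net: an uncovered unit vector could be added to it.
  obtain ⟨s, hs, hcard⟩ : sSup A ∈ A := Nat.sSup_mem ⟨0, ∅, by simp [Good], by simp⟩ hbdd
  refine ⟨s, hs.1, hbound s hs, fun x hx => ?_⟩
  by_contra! hfar
  have hxs : x ∉ s := fun hxs => by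
    have := hfar x hxs
    simp at this
    linarith
  have hins : Good (insert x s) := by
    refine ⟨by simpa [hx] using hs.1, ?_⟩
    simp only [Finset.mem_insert, forall_eq_or_imp]
    refine ⟨⟨fun h => (h rfl).elim, fun d hd _ => hfar d hd⟩, fun c hc => ⟨fun _ => ?_, hs.2 c hc⟩⟩
    rw [norm_sub_rev]
    exact hfar c hc
  have := le_csSup hbdd ⟨_, hins, rfl⟩
  rw [Finset.card_insert_of_notMem hxs, hcard] at this
  omega

variable {F : Type*} [NormedAddCommGroup F] [NormedSpace ℝ F]

theorem norm_inv_norm_smul {y : F} (hy : y ≠ 0) : ‖(‖y‖⁻¹ • y)‖ = 1 := by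
  rw [norm_smul, norm_inv, norm_norm, inv_mul_cancel₀ (norm_ne_zero_iff.2 hy)]

/-- Two-sided control of a linear map on a net of the sphere gives a lower bound everywhere. -/
theorem le_norm_of_net (s : Finset E) (hnet : ∀ x : E, ‖x‖ = 1 → ∃ c ∈ s, ‖x - c‖ < 1 / 17)
    (G : E →ₗ[ℝ] F) {a : ℝ} (hlow : ∀ c ∈ s, a / 4 ≤ ‖G c‖) (hup : ∀ c ∈ s, ‖G c‖ ≤ 2 * a)
    (x : E) : a / 8 * ‖x‖ ≤ ‖G x‖ := by
  let G' : E →L[ℝ] F := LinearMap.toContinuousLinearMap G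
  have hG' y : ‖G y‖ ≤ ‖G'‖ * ‖y‖ := G'.le_opNorm y
  rcases eq_or_ne x 0 with rfl | hx
  · simp
  have hnx : 0 < ‖x‖ := norm_pos_iff.2 hx
  have hscale (y : E) (hy : y ≠ 0) : ‖G y‖ = ‖y‖ * ‖G (‖y‖⁻¹ • y)‖ := by
    rw [map_smul, norm_smul, norm_inv, norm_norm, mul_inv_cancel_left₀ (norm_ne_zero_iff.2 hy)]
  have ha : 0 ≤ a := by
    obtain ⟨c, hc, -⟩ := hnet _ (norm_inv_norm_smul hx)
    linarith [hlow c hc, hup c hc, norm_nonneg (G c)]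
  -- Self-bounding gives ‖G'‖ ≤ 17a/8, so passing to a net point at distance below 1/17 costs at
  -- most a/8, half of the lower bound a/4.
  have hop : ‖G'‖ ≤ 2 * a + ‖G'‖ * (1 / 17) := by
    refine G'.opNorm_le_bound (by positivity) fun y => ?_
    rcases eq_or_ne y 0 with rfl | hy
    · simp
    change ‖G y‖ ≤ _
    rw [hscale y hy, mul_comm]
    refine mul_le_mul_of_nonneg_right ?_ (norm_nonneg _)
    obtain ⟨c, hc, hd⟩ := hnet _ (norm_inv_norm_smul hy)
    calc ‖G (‖y‖⁻¹ • y)‖ = ‖G c + G (‖y‖⁻¹ • y - c)‖ := by rw [← map_add, add_sub_cancel]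
      _ ≤ ‖G c‖ + ‖G (‖y‖⁻¹ • y - c)‖ := norm_add_le _ _
      _ ≤ 2 * a + ‖G'‖ * (1 / 17) := by
        refine add_le_add (hup c hc) ((hG' _).trans ?_)
        exact mul_le_mul_of_nonneg_left hd.le (norm_nonneg _)
  rw [hscale x hx, mul_comm]
  refine mul_le_mul_of_nonneg_left ?_ (norm_nonneg _)
  obtain ⟨c, hc, hd⟩ := hnet _ (norm_inv_norm_smul hx)
  have h1 : ‖G c‖ ≤ ‖G (‖x‖⁻¹ • x)‖ + ‖G (‖x‖⁻¹ • x - c)‖ := by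
    calc ‖G c‖ = ‖G (‖x‖⁻¹ • x) - G (‖x‖⁻¹ • x - c)‖ := by rw [← map_sub, sub_sub_cancel]
      _ ≤ _ := norm_sub_le _ _
  have h2 := (hG' (‖x‖⁻¹ • x - c)).trans (mul_le_mul_of_nonneg_left hd.le (norm_nonneg _))
  linarith [hlow c hc]

end Net

/-! ### Operator norms from bilinear forms on nets -/

section BilinearNet

variable {E F : Type*} [NormedAddCommGroup E] [InnerProductSpace ℝ E] [FiniteDimensional ℝ E]
  [NormedAddCommGroup F] [InnerProductSpace ℝ F]

/-- Control of a bilinear form on `1/4`-nets of the spheres bounds its norm. -/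
theorem norm_le_of_net (s : Finset E) (t : Finset F)
    (hs1 : ∀ c ∈ s, ‖c‖ = 1)
    (hs : ∀ x : E, ‖x‖ = 1 → ∃ c ∈ s, ‖x - c‖ < 1 / 4)
    (ht : ∀ x : F, ‖x‖ = 1 → ∃ c ∈ t, ‖x - c‖ < 1 / 4)
    (N : E →ₗ[ℝ] F) {a : ℝ} (ha : 0 ≤ a) (hbd : ∀ x ∈ s, ∀ y ∈ t, ⟪y, N x⟫_ℝ ≤ a) (x : E) :
    ‖N x‖ ≤ 2 * a * ‖x‖ := by
  let N' : E →L[ℝ] F := LinearMap.toContinuousLinearMap N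
  have hN' y : ‖N y‖ ≤ ‖N'‖ * ‖y‖ := N'.le_opNorm y
  have hscale (y : E) (hy : y ≠ 0) : ‖N y‖ = ‖y‖ * ‖N (‖y‖⁻¹ • y)‖ := by
    rw [map_smul, norm_smul, norm_inv, norm_norm, mul_inv_cancel_left₀ (norm_ne_zero_iff.2 hy)]
  -- Each argument moved to its 1/4-net costs ‖N'‖/4; solving the inequality for ‖N'‖ produces the
  -- factor 2.
  have hop : ‖N'‖ ≤ a + ‖N'‖ * (1 / 2) := by
    refine N'.opNorm_le_bound (by positivity) fun y => ?_
    rcases eq_or_ne y 0 with rfl | hy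
    · simp
    change ‖N y‖ ≤ _
    rw [hscale y hy, mul_comm]
    refine mul_le_mul_of_nonneg_right ?_ (norm_nonneg _)
    set e := ‖y‖⁻¹ • y
    have he : ‖e‖ = 1 := norm_inv_norm_smul hy
    rcases eq_or_ne (N e) 0 with h0 | h0
    · rw [h0, norm_zero]; positivity
    set f := ‖N e‖⁻¹ • N e with hf
    have hf1 : ‖f‖ = 1 := norm_inv_norm_smul h0
    have hfe : ⟪f, N e⟫_ℝ = ‖N e‖ := by
      rw [hf, inner_smul_left, real_inner_self_eq_norm_sq, conj_trivial, sq,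
        inv_mul_cancel_left₀ (norm_ne_zero_iff.2 h0)]
    obtain ⟨c, hc, hcd⟩ := hs e he
    obtain ⟨d, hd, hdd⟩ := ht f hf1
    have hsum : ⟪f, N e⟫_ℝ = ⟪d, N c⟫_ℝ + ⟪f - d, N c⟫_ℝ + ⟪f, N (e - c)⟫_ℝ := by
      rw [map_sub, inner_sub_left, inner_sub_right]; ring
    have h1 : ⟪f - d, N c⟫_ℝ ≤ 1 / 4 * ‖N'‖ := by
      refine (real_inner_le_norm _ _).trans (mul_le_mul hdd.le ?_ (norm_nonneg _) (by norm_num))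
      simpa [hs1 c hc] using hN' c
    have h2 : ⟪f, N (e - c)⟫_ℝ ≤ ‖N'‖ * (1 / 4) := by
      refine (real_inner_le_norm _ _).trans ?_
      rw [hf1, one_mul]
      exact (hN' _).trans (mul_le_mul_of_nonneg_left hcd.le (norm_nonneg _))
    linarith [hbd c hc d hd]
  refine (hN' x).trans (mul_le_mul_of_nonneg_right ?_ (norm_nonneg _))
  linarith

end BilinearNet

/-! ### Exponential moments and Chernoff bounds for Gaussian sums -/

section Gaussian

open scoped ENNReal NNReal

/-- The tilted density is again an unnormalised Gaussian. Negative `s` is allowed, so the same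
formula serves both tails. -/
theorem lintegral_exp_sq_gaussianReal (v : ℝ≥0) {s : ℝ} (hs : 2 * s * v < 1) :
    ∫⁻ x, ENNReal.ofReal (Real.exp (s * x ^ 2)) ∂gaussianReal 0 v =
      ENNReal.ofReal ((√(1 - 2 * s * v))⁻¹) := by
  rcases eq_or_ne v 0 with rfl | hv
  · simp [gaussianReal_zero_var]
  have hv0 : (0 : ℝ) < v := by positivity
  set b : ℝ := (1 - 2 * s * v) / (2 * v) with hb
  have hb0 : 0 < b := div_pos (by linarith) (by positivity)
  rw [gaussianReal_of_var_ne_zero _ hv,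
    lintegral_withDensity_eq_lintegral_mul _ (by fun_prop) (by fun_prop)]
  have hpt (x : ℝ) : (gaussianPDF 0 v * fun x => ENNReal.ofReal (Real.exp (s * x ^ 2))) x =
      ENNReal.ofReal ((√(2 * Real.pi * v))⁻¹ * Real.exp (-b * x ^ 2)) := by
    rw [Pi.mul_apply, gaussianPDF, ← ENNReal.ofReal_mul (gaussianPDFReal_nonneg _ _ _),
      gaussianPDFReal, mul_assoc, ← Real.exp_add]
    congr 3
    rw [hb]
    field_simp
    ring
  simp_rw [hpt]
  rw [← ofReal_integral_eq_lintegral_ofReal ((integrable_exp_neg_mul_sq hb0).const_mul _)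
    (Filter.Eventually.of_forall fun x => by positivity), integral_const_mul, integral_gaussian]
  congr 1
  rw [← Real.sqrt_inv, ← Real.sqrt_mul (by positivity), ← Real.sqrt_inv]
  congr 1
  rw [hb]
  have : 1 - 2 * s * (v : ℝ) ≠ 0 := by linarith
  field_simp

theorem lintegral_exp_mul_gaussianReal (v : ℝ≥0) (t : ℝ) :
    ∫⁻ x, ENNReal.ofReal (Real.exp (t * x)) ∂gaussianReal 0 v =
      ENNReal.ofReal (Real.exp (v * t ^ 2 / 2)) := by
  rw [← ofReal_integral_eq_lintegral_ofReal (integrable_exp_mul_gaussianReal t)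
    (Filter.Eventually.of_forall fun x => by positivity)]
  congr 1
  have := congrFun (mgf_fun_id_gaussianReal (μ := 0) (v := v)) t
  simpa [mgf] using this

variable {Ω : Type*} [MeasurableSpace Ω] {P : Measure Ω}

theorem hasLaw_inner_multivariateGaussian {d : ℕ} {S : Matrix (Fin d) (Fin d) ℝ}
    (hS : S.PosSemidef) {X : Ω → EuclideanSpace ℝ (Fin d)}
    (hX : HasLaw X (multivariateGaussian 0 S) P) (v : EuclideanSpace ℝ (Fin d)) :
    HasLaw (fun ω => ⟪v, X ω⟫_ℝ) (gaussianReal 0 (v ⬝ᵥ S.mulVec v).toNNReal) P := by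
  have hmp : MeasurePreserving (fun y => ⟪v, y⟫_ℝ) (multivariateGaussian 0 S)
      (gaussianReal 0 (v ⬝ᵥ S.mulVec v).toNNReal) := by
    refine ⟨by fun_prop, ?_⟩
    have hmap := IsGaussian.map_eq_gaussianReal (μ := multivariateGaussian 0 S) (innerSL ℝ v)
    have hmean : (multivariateGaussian 0 S)[innerSL ℝ v] = 0 := by
      rw [ContinuousLinearMap.integral_comp_id_comm]
      · simp
      · exact IsGaussian.integrable_id
    have hvar : Var[innerSL ℝ v; multivariateGaussian 0 S] = v ⬝ᵥ S.mulVec v := by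
      rw [← covarianceBilin_multivariateGaussian (μ := 0) hS,
        covarianceBilin_self IsGaussian.memLp_two_id]
      rfl
    rw [hmean, hvar] at hmap
    exact hmap
  exact hmp.fun_comp_hasLaw hX

theorem measure_le_of_lintegral_exp {Y : Ω → ℝ} (hY : AEMeasurable Y P) (r : ℝ) :
    P {ω | r ≤ Y ω} ≤
      ENNReal.ofReal (Real.exp (-r)) * ∫⁻ ω, ENNReal.ofReal (Real.exp (Y ω)) ∂P := by
  have hmarkov := mul_meas_ge_le_lintegral₀ (μ := P)
    (f := fun ω => ENNReal.ofReal (Real.exp (Y ω))) (by fun_prop) (ENNReal.ofReal (Real.exp r))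
  have hset : {ω | ENNReal.ofReal (Real.exp r) ≤ ENNReal.ofReal (Real.exp (Y ω))} =
      {ω | r ≤ Y ω} := by
    ext ω
    simp [ENNReal.ofReal_le_ofReal_iff (Real.exp_pos _).le]
  rw [hset] at hmarkov
  calc P {ω | r ≤ Y ω} = ENNReal.ofReal (Real.exp (-r)) *
        (ENNReal.ofReal (Real.exp r) * P {ω | r ≤ Y ω}) := by
        rw [← mul_assoc, ← ENNReal.ofReal_mul (Real.exp_pos _).le, ← Real.exp_add]
        simp
    _ ≤ _ := by gcongr

variable {n : ℕ} {x w : Fin n → Ω → ℝ}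

theorem lintegral_exp_sum_of_iIndepFun (hx : ∀ a, AEMeasurable (x a) P) (hind : iIndepFun x P)
    {g : Fin n → ℝ → ℝ} (hg : ∀ a, Measurable (g a)) :
    ∫⁻ ω, ENNReal.ofReal (Real.exp (∑ a, g a (x a ω))) ∂P =
      ∏ a, ∫⁻ ω, ENNReal.ofReal (Real.exp (g a (x a ω))) ∂P := by
  -- The variables are only a.e. measurable, so the product formula is applied to measurable
  -- modifications.
  have hae (a : Fin n) := (hx a).ae_eq_mk
  have hcomp := (hind.congr hae).comp (fun a y => ENNReal.ofReal (Real.exp (g a y)))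
    fun a => by fun_prop
  have hprod := lintegral_prod_eq_prod_lintegral_of_indepFun (μ := P) Finset.univ
    (fun a ω => ENNReal.ofReal (Real.exp (g a ((hx a).mk (x a) ω)))) hcomp
    (fun a => ((hg a).exp.ennreal_ofReal).comp (hx a).measurable_mk)
  calc _ = ∫⁻ ω, ∏ a, ENNReal.ofReal (Real.exp (g a ((hx a).mk (x a) ω))) ∂P := by
        refine lintegral_congr_ae ?_
        filter_upwards [ae_all_iff.2 hae] with ω hω
        simp only [hω, Real.exp_sum, ENNReal.ofReal_prod_of_nonneg fun _ _ => (Real.exp_pos _).le]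
    _ = _ := hprod
    _ = _ := Finset.prod_congr rfl fun a _ => lintegral_congr_ae <| by
        filter_upwards [hae a] with ω hω
        rw [hω]

theorem lintegral_exp_sum_sq_gaussian {v : ℝ≥0} (hx : ∀ a, HasLaw (x a) (gaussianReal 0 v) P)
    (hind : iIndepFun x P) {s : ℝ} (hs : 2 * s * v < 1) :
    ∫⁻ ω, ENNReal.ofReal (Real.exp (s * ∑ a, x a ω ^ 2)) ∂P =
      ENNReal.ofReal ((√(1 - 2 * s * v))⁻¹ ^ n) := by
  simp_rw [Finset.mul_sum]
  rw [lintegral_exp_sum_of_iIndepFun (g := fun _ y => s * y ^ 2) (fun a => (hx a).aemeasurable)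
    hind (fun a => by fun_prop), ENNReal.ofReal_pow (by positivity)]
  have hone (a : Fin n) := (hx a).lintegral_comp
    (f := fun y => ENNReal.ofReal (Real.exp (s * y ^ 2))) (by fun_prop)
  simp [hone, lintegral_exp_sq_gaussianReal v hs]

/-- Chernoff bound for a sum of squares of independent centered Gaussians. -/
theorem measure_le_mul_sum_sq_gaussian {v : ℝ≥0} (hx : ∀ a, HasLaw (x a) (gaussianReal 0 v) P)
    (hind : iIndepFun x P) {s : ℝ} (hs : 2 * s * v < 1) (r : ℝ) :
    P {ω | r ≤ s * ∑ a, x a ω ^ 2} ≤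
      ENNReal.ofReal (Real.exp (-r) * (√(1 - 2 * s * v))⁻¹ ^ n) := by
  have hmeas (a : Fin n) : AEMeasurable (x a) P := (hx a).aemeasurable
  refine (measure_le_of_lintegral_exp (by fun_prop) r).trans ?_
  rw [lintegral_exp_sum_sq_gaussian hx hind hs, ENNReal.ofReal_mul (Real.exp_pos _).le]

variable [IsProbabilityMeasure P]

/-- Conditionally on `x` the sum is Gaussian with variance β ∑ x_a². Integrating over `w` first
leaves the exponential moment of a sum of squares, with parameter t²β/2. -/
theorem lintegral_exp_sum_mul_gaussian {α β : ℝ≥0}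
    (hx : ∀ a, HasLaw (x a) (gaussianReal 0 α) P) (hw : ∀ a, HasLaw (w a) (gaussianReal 0 β) P)
    (hxind : iIndepFun x P) (hwind : iIndepFun w P)
    (hind : IndepFun (fun ω a => x a ω) (fun ω a => w a ω) P) {t : ℝ} (ht : t ^ 2 * α * β < 1) :
    ∫⁻ ω, ENNReal.ofReal (Real.exp (t * ∑ a, x a ω * w a ω)) ∂P =
      ENNReal.ofReal ((√(1 - t ^ 2 * α * β))⁻¹ ^ n) := by
  have hxm (a : Fin n) : AEMeasurable (x a) P := (hx a).aemeasurable
  have hwm (a : Fin n) : AEMeasurable (w a) P := (hw a).aemeasurable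
  have hxv : AEMeasurable (fun ω a => x a ω) P := aemeasurable_pi_lambda _ hxm
  have hwv : AEMeasurable (fun ω a => w a ω) P := aemeasurable_pi_lambda _ hwm
  let f : (Fin n → ℝ) × (Fin n → ℝ) → ℝ≥0∞ := fun z =>
    ENNReal.ofReal (Real.exp (t * ∑ a, z.1 a * z.2 a))
  have hf : Measurable f := by fun_prop
  have hinner (y : Fin n → ℝ) : ∫⁻ ω, f (y, fun a => w a ω) ∂P =
      ENNReal.ofReal (Real.exp (t ^ 2 * β / 2 * ∑ a, y a ^ 2)) := by
    simp only [f, Finset.mul_sum]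
    rw [lintegral_exp_sum_of_iIndepFun (g := fun a u => t * (y a * u)) hwm hwind
      (fun a => by fun_prop), Real.exp_sum,
      ENNReal.ofReal_prod_of_nonneg fun _ _ => (Real.exp_pos _).le]
    refine Finset.prod_congr rfl fun a _ => ?_
    have hone := (hw a).lintegral_comp
      (f := fun u => ENNReal.ofReal (Real.exp (t * y a * u))) (by fun_prop)
    simp_rw [← mul_assoc]
    rw [hone, lintegral_exp_mul_gaussianReal]
    congr 2
    ring
  calc ∫⁻ ω, ENNReal.ofReal (Real.exp (t * ∑ a, x a ω * w a ω)) ∂P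
      = ∫⁻ z, f z ∂(P.map fun ω => ((fun a => x a ω), (fun a => w a ω))) := by
        rw [lintegral_map' hf.aemeasurable (hxv.prodMk hwv)]
    _ = ∫⁻ y, ∫⁻ u, f (y, u) ∂(P.map fun ω a => w a ω) ∂(P.map fun ω a => x a ω) := by
        rw [hind.map_prod_eq_prod_map_map hxv hwv]
        have := Measure.isProbabilityMeasure_map (μ := P) hwv
        rw [lintegral_prod _ hf.aemeasurable]
    _ = ∫⁻ y, ENNReal.ofReal (Real.exp (t ^ 2 * β / 2 * ∑ a, y a ^ 2))
          ∂(P.map fun ω a => x a ω) := by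
        refine lintegral_congr fun y => ?_
        rw [lintegral_map' (Measurable.aemeasurable (by fun_prop)) hwv, hinner]
    _ = ENNReal.ofReal ((√(1 - t ^ 2 * α * β))⁻¹ ^ n) := by
        rw [lintegral_map' (Measurable.aemeasurable (by fun_prop)) hxv]
        have hs : 2 * (t ^ 2 * β / 2) * (α : ℝ) = t ^ 2 * α * β := by ring
        rw [lintegral_exp_sum_sq_gaussian hx hxind (by rw [hs]; exact ht), hs]

/-- Chernoff bound for a sum of products of independent centered Gaussians. -/
theorem measure_le_sum_mul_gaussian {α β : ℝ≥0}
    (hx : ∀ a, HasLaw (x a) (gaussianReal 0 α) P) (hw : ∀ a, HasLaw (w a) (gaussianReal 0 β) P)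
    (hxind : iIndepFun x P) (hwind : iIndepFun w P)
    (hind : IndepFun (fun ω a => x a ω) (fun ω a => w a ω) P) {t : ℝ} (ht : t ^ 2 * α * β < 1)
    (r : ℝ) :
    P {ω | r ≤ t * ∑ a, x a ω * w a ω} ≤
      ENNReal.ofReal (Real.exp (-r) * (√(1 - t ^ 2 * α * β))⁻¹ ^ n) := by
  have hxm (a : Fin n) : AEMeasurable (x a) P := (hx a).aemeasurable
  have hwm (a : Fin n) : AEMeasurable (w a) P := (hw a).aemeasurable
  refine (measure_le_of_lintegral_exp (by fun_prop) r).trans ?_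
  rw [lintegral_exp_sum_mul_gaussian hx hw hxind hwind hind ht,
    ENNReal.ofReal_mul (Real.exp_pos _).le]

end Gaussian

/-! ### Deterministic analysis of the estimator -/

section Deterministic

variable {k p n : ℕ}

/-- The additional indices lie beyond the rank. Taking a general `g` covers both the nuclear norm
and the ℓ_q sum, whose convention 0^0 = 0 is exactly what `hg` requires. -/
theorem sum_range_singularValue (Θ : Matrix (Fin k) (Fin p) ℝ) {g : ℝ → ℝ} (hg : g 0 = 0) :
    ∑ i ∈ Finset.range (min k p), g (singularValue Θ i) =
      ∑ i : Fin p, g ((toLin Θ).singularValues i) := by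
  rw [Fin.sum_univ_eq_sum_range fun i => g ((toLin Θ).singularValues i)]
  refine Finset.sum_subset (Finset.range_subset_range.2 (min_le_right _ _)) fun i hi hni => ?_
  rw [Finset.mem_range] at hi hni
  have hki : k ≤ i := by omega
  have : singularValue Θ i = 0 := by
    change (toLin Θ).singularValues i = 0
    rw [LinearMap.singularValues_eq_zero_iff_le_finrank_range]
    refine (Submodule.finrank_le _).trans ?_
    simpa using hki
  rw [this, hg]

theorem nuclearNorm_eq_sum (Θ : Matrix (Fin k) (Fin p) ℝ) :
    nuclearNorm Θ = ∑ i : Fin p, (toLin Θ).singularValues i :=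
  sum_range_singularValue Θ (g := id) rfl

theorem frobeniusSq_eq_traceInner (Θ : Matrix (Fin k) (Fin p) ℝ) :
    frobeniusSq Θ = traceInner (toLin Θ) (toLin Θ) := by
  rw [traceInner_eq_sum _ _ (EuclideanSpace.basisFun (Fin p) ℝ), frobeniusSq, Finset.sum_comm]
  refine Finset.sum_congr rfl fun j _ => ?_
  rw [real_inner_self_eq_norm_sq, EuclideanSpace.real_norm_sq_eq]
  simp [toLin]

/-- The empirical cross-covariance map `v ↦ n⁻¹ ∑ a, ⟪x a, v⟫ w a`. -/
noncomputable def crossMap (x : Fin n → EuclideanSpace ℝ (Fin p))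
    (w : Fin n → EuclideanSpace ℝ (Fin k)) :
    EuclideanSpace ℝ (Fin p) →ₗ[ℝ] EuclideanSpace ℝ (Fin k) :=
  (n : ℝ)⁻¹ • ∑ a, (innerₛₗ ℝ (x a)).smulRight (w a)

theorem crossMap_apply (x : Fin n → EuclideanSpace ℝ (Fin p))
    (w : Fin n → EuclideanSpace ℝ (Fin k)) (v : EuclideanSpace ℝ (Fin p)) :
    crossMap x w v = (n : ℝ)⁻¹ • ∑ a, ⟪x a, v⟫_ℝ • w a := by
  simp [crossMap]

theorem traceInner_crossMap (x : Fin n → EuclideanSpace ℝ (Fin p))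
    (w : Fin n → EuclideanSpace ℝ (Fin k))
    (D : EuclideanSpace ℝ (Fin p) →ₗ[ℝ] EuclideanSpace ℝ (Fin k)) :
    traceInner (crossMap x w) D = (n : ℝ)⁻¹ * ∑ a, ⟪w a, D (x a)⟫_ℝ := by
  set b := EuclideanSpace.basisFun (Fin p) ℝ
  rw [traceInner_eq_sum _ _ b]
  simp_rw [crossMap_apply, inner_smul_left, sum_inner, ← Finset.mul_sum, conj_trivial]
  rw [Finset.sum_comm]
  congr 1
  refine Finset.sum_congr rfl fun a _ => ?_
  conv_rhs => rw [← b.sum_repr' (x a)]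
  rw [map_sum, inner_sum]
  refine Finset.sum_congr rfl fun i _ => ?_
  rw [map_smul, inner_smul_left, inner_smul_right, real_inner_comm, conj_trivial]

/-- The basic inequality for a solution of the regularized least-squares problem. -/
theorem IsSolution.basic_inequality {x : Fin n → EuclideanSpace ℝ (Fin p)}
    {w z : Fin n → EuclideanSpace ℝ (Fin k)} {l : ℝ} {Θstar Θhat : Matrix (Fin k) (Fin p) ℝ}
    (hz : ∀ a, z a = toLin Θstar (x a) + w a) (h : IsSolution x z l Θhat) :
    1 / 2 * ((n : ℝ)⁻¹ * ∑ a, ‖toLin (Θhat - Θstar) (x a)‖ ^ 2) ≤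
      traceInner (crossMap x w) (toLin (Θhat - Θstar)) +
        l * (nuclearNorm Θstar - nuclearNorm Θhat) := by
  have hobj := h Θstar
  rw [objective, objective] at hobj
  have hstar a : ‖z a - toLin Θstar (x a)‖ ^ 2 = ‖w a‖ ^ 2 := by
    rw [hz, add_sub_cancel_left]
  have hhat a : ‖z a - toLin Θhat (x a)‖ ^ 2 = ‖w a‖ ^ 2 -
      2 * ⟪w a, toLin (Θhat - Θstar) (x a)⟫_ℝ + ‖toLin (Θhat - Θstar) (x a)‖ ^ 2 := by
    rw [← norm_sub_sq_real, hz]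
    congr 2
    simp only [toLin, map_sub, LinearMap.sub_apply]
    abel
  simp_rw [hstar, hhat, Finset.sum_add_distrib, Finset.sum_sub_distrib, ← Finset.mul_sum] at hobj
  rw [traceInner_crossMap]
  have : 1 / (2 * (n : ℝ)) = 1 / 2 * (n : ℝ)⁻¹ := by rw [one_div, mul_inv, one_div]
  rw [this] at hobj
  linarith

/-- Above the threshold τ^q ≤ σ^q, so each retained index uses up at least τ^q of the budget `R`;
below it σ = σ^q σ^(1−q) ≤ σ^q τ^(1−q). -/
theorem card_mul_sq_add_le_of_mem_schattenBall {q R τ : ℝ} (hq0 : 0 ≤ q) (hq1 : q ≤ 1)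
    (hτ : 0 < τ) {Θ : Matrix (Fin k) (Fin p) ℝ} (hΘ : Θ ∈ schattenBall k p q R)
    (s : Finset (Fin p)) (hs : ∀ i, i ∈ s ↔ τ < (toLin Θ).singularValues i) :
    τ ^ 2 * s.card ≤ R * τ ^ (2 - q) ∧
      τ * ∑ i ∈ sᶜ, (toLin Θ).singularValues i ≤ R * τ ^ (2 - q) := by
  classical
  set g : ℝ → ℝ := fun σ => if σ = 0 then 0 else σ ^ q with hg
  have hR : ∑ i : Fin p, g ((toLin Θ).singularValues i) ≤ R := by
    rw [← sum_range_singularValue Θ (by simp [hg])]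
    exact hΘ
  have hg0 i : 0 ≤ g ((toLin Θ).singularValues i) := by
    have := (toLin Θ).singularValues_nonneg i
    simp only [hg]
    split_ifs <;> positivity
  have hsub (t : Finset (Fin p)) :
      ∑ i ∈ t, g ((toLin Θ).singularValues i) * τ ^ (2 - q) ≤ R * τ ^ (2 - q) := by
    rw [← Finset.sum_mul]
    refine mul_le_mul_of_nonneg_right (le_trans ?_ hR) (by positivity)
    exact Finset.sum_le_sum_of_subset_of_nonneg (Finset.subset_univ _) fun i _ _ => hg0 i
  constructor
  · refine le_trans ?_ (hsub s)
    rw [mul_comm, ← nsmul_eq_mul, ← Finset.sum_const]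
    refine Finset.sum_le_sum fun i hi => ?_
    have hi' := (hs i).1 hi
    simp only [hg, if_neg (hτ.trans hi').ne']
    calc τ ^ 2 = τ ^ q * τ ^ (2 - q) := by
          rw [← Real.rpow_add hτ, add_sub_cancel, Real.rpow_two]
      _ ≤ _ := by gcongr
  · refine le_trans ?_ (hsub sᶜ)
    rw [Finset.mul_sum]
    refine Finset.sum_le_sum fun i hi => ?_
    have hle : (toLin Θ).singularValues i ≤ τ := by
      rw [Finset.mem_compl, hs, not_lt] at hi
      exact hi
    rcases ((toLin Θ).singularValues_nonneg i).eq_or_lt with h0 | h0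
    · simp [hg, ← h0]
    simp only [hg, if_neg h0.ne']
    calc τ * (toLin Θ).singularValues i
        = τ * ((toLin Θ).singularValues i ^ q * (toLin Θ).singularValues i ^ (1 - q)) := by
          rw [← Real.rpow_add h0, add_sub_cancel, Real.rpow_one]
      _ ≤ τ * ((toLin Θ).singularValues i ^ q * τ ^ (1 - q)) := by
          gcongr
      _ = (toLin Θ).singularValues i ^ q * τ ^ (2 - q) := by
          rw [show 2 - q = 1 + (1 - q) by ring, Real.rpow_add hτ, Real.rpow_one]
          ring

/-- Deterministic error bound under restricted strong convexity and a bound on the noise. -/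
theorem IsSolution.frobeniusSq_sub_le {x : Fin n → EuclideanSpace ℝ (Fin p)}
    {w z : Fin n → EuclideanSpace ℝ (Fin k)} {q R l κ : ℝ} {Θstar Θhat : Matrix (Fin k) (Fin p) ℝ}
    (hq0 : 0 ≤ q) (hq1 : q ≤ 1) (hl : 0 < l) (hκ : 0 < κ)
    (hstar : Θstar ∈ schattenBall k p q R)
    (hz : ∀ a, z a = toLin Θstar (x a) + w a)
    (hnoise : ∀ v, ‖crossMap x w v‖ ≤ l / 2 * ‖v‖)
    (hrsc : ∀ D : Matrix (Fin k) (Fin p) ℝ,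
      κ * frobeniusSq D ≤ (n : ℝ)⁻¹ * ∑ a, ‖toLin D (x a)‖ ^ 2)
    (h : IsSolution x z l Θhat) :
    frobeniusSq (Θhat - Θstar) ≤ 22 * R * (l / κ) ^ (2 - q) := by
  classical
  -- This threshold balances estimation error against tail: both become multiples of R τ^(2−q).
  set τ := l / κ with hτ_def
  have hτ : 0 < τ := div_pos hl hκ
  have hlτ : l = κ * τ := by rw [hτ_def, mul_div_cancel₀ _ hκ.ne']
  set s : Finset (Fin p) := Finset.univ.filter fun i => τ < (toLin Θstar).singularValues i
  have hs i : i ∈ s ↔ τ < (toLin Θstar).singularValues i := by simp [s]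
  obtain ⟨hcard, htail⟩ := card_mul_sq_add_le_of_mem_schattenBall hq0 hq1 hτ hstar s hs
  set D := Θhat - Θstar with hD
  have hbasic := h.basic_inequality hz
  have hsum : toLin Θstar + toLin D = toLin Θhat := by
    simp only [toLin, hD, ← map_add, add_sub_cancel]
  have hcert := traceInner_add_sum_singularValues_sub_le (finrank_euclideanSpace_fin)
    (toLin Θstar) (toLin D) (crossMap x w) hl hnoise s fun i hi => hτ.trans ((hs i).1 hi)
  rw [hsum, ← nuclearNorm_eq_sum, ← nuclearNorm_eq_sum, ← frobeniusSq_eq_traceInner] at hcert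
  have hF0 : 0 ≤ frobeniusSq D :=
    Finset.sum_nonneg fun _ _ => Finset.sum_nonneg fun _ _ => sq_nonneg _
  have hFsq := Real.sq_sqrt hF0
  have hrsq := Real.sq_sqrt (Nat.cast_nonneg (α := ℝ) s.card)
  set f := √(frobeniusSq D)
  set r := √(s.card : ℝ)
  set b := ∑ i ∈ sᶜ, (toLin Θstar).singularValues i
  have hmain : κ * (frobeniusSq D) ≤ κ * (4 * (τ * r) * f + 3 * (τ * b)) := by
    have := hrsc D
    rw [hlτ] at hcert hbasic
    linarith
  have hmain' := le_of_mul_le_mul_left hmain hκ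
  -- Half of the squared error is absorbed on the left; the remaining 8 + 3 = 11 doubles to the
  -- constant 22.
  have hamgm : 4 * (τ * r) * f ≤ 8 * (τ ^ 2 * s.card) + 1 / 2 * frobeniusSq D := by
    rw [← hrsq, ← hFsq]
    nlinarith [sq_nonneg (4 * (τ * r) - f)]
  linarith

theorem sum_sq_toLin_eq (D : Matrix (Fin k) (Fin p) ℝ) (v : EuclideanSpace ℝ (Fin p)) :
    ‖toLin D v‖ ^ 2 = ∑ i, ⟪v, WithLp.toLp 2 (D i)⟫_ℝ ^ 2 := by
  rw [EuclideanSpace.real_norm_sq_eq]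
  refine Finset.sum_congr rfl fun i _ => ?_
  simp [toLin, PiLp.inner_apply, Matrix.mulVec, dotProduct]

/-- Both sides split over the rows of `D`, which reduces matrix curvature to vector curvature. -/
theorem mul_frobeniusSq_le {x : Fin n → EuclideanSpace ℝ (Fin p)} {c : ℝ}
    (h : ∀ v, c * ‖v‖ ^ 2 ≤ ∑ a, ⟪x a, v⟫_ℝ ^ 2) (D : Matrix (Fin k) (Fin p) ℝ) :
    c * frobeniusSq D ≤ ∑ a, ‖toLin D (x a)‖ ^ 2 := by
  simp_rw [sum_sq_toLin_eq]
  rw [Finset.sum_comm, frobeniusSq, Finset.mul_sum]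
  refine Finset.sum_le_sum fun i _ => le_trans (le_of_eq ?_) (h (WithLp.toLp 2 (D i)))
  rw [EuclideanSpace.real_norm_sq_eq]

theorem sum_inner_sq_ge_of_net {x : Fin n → EuclideanSpace ℝ (Fin p)}
    (B : EuclideanSpace ℝ (Fin p) →ₗ[ℝ] EuclideanSpace ℝ (Fin p))
    (s : Finset (EuclideanSpace ℝ (Fin p)))
    (hnet : ∀ y : EuclideanSpace ℝ (Fin p), ‖y‖ = 1 → ∃ c ∈ s, ‖y - c‖ < 1 / 17)
    (hlow : ∀ c ∈ s, (n : ℝ) / 16 ≤ ∑ a, ⟪B c, x a⟫_ℝ ^ 2)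
    (hup : ∀ c ∈ s, ∑ a, ⟪B c, x a⟫_ℝ ^ 2 ≤ 4 * n) (y : EuclideanSpace ℝ (Fin p)) :
    n / 64 * ‖y‖ ^ 2 ≤ ∑ a, ⟪B y, x a⟫_ℝ ^ 2 := by
  -- The whitened design as a linear map; the net bound is used with a = √n, whence n/16, 4n and
  -- n/64.
  let G : EuclideanSpace ℝ (Fin p) →ₗ[ℝ] EuclideanSpace ℝ (Fin n) :=
    (WithLp.linearEquiv 2 ℝ (Fin n → ℝ)).symm.toLinearMap ∘ₗ
      LinearMap.pi fun a => innerₛₗ ℝ (x a) ∘ₗ B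
  have hG y : ‖G y‖ ^ 2 = ∑ a, ⟪B y, x a⟫_ℝ ^ 2 := by
    rw [EuclideanSpace.real_norm_sq_eq]
    simp [G, real_inner_comm]
  have hn : √(n : ℝ) ^ 2 = n := Real.sq_sqrt (Nat.cast_nonneg n)
  have hbd := le_norm_of_net s hnet G (a := √n)
    (fun c hc => le_of_sq_le_sq (by rw [hG, div_pow, hn]; linarith [hlow c hc]) (norm_nonneg _))
    (fun c hc => le_of_sq_le_sq (by rw [hG, mul_pow, hn]; linarith [hup c hc]) (by positivity)) y
  have := pow_le_pow_left₀ (by positivity) hbd 2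
  rw [hG, mul_pow, div_pow, hn] at this
  linarith

end Deterministic

/-! ### Spectral bounds and whitening of the covariance -/

section QuadraticForm

variable {p : ℕ} {S : Matrix (Fin p) (Fin p) ℝ}

theorem dotProduct_mulVec_eq_sum (hS : S.IsHermitian) (v : EuclideanSpace ℝ (Fin p)) :
    v ⬝ᵥ S.mulVec v = ∑ i, hS.eigenvalues i * ⟪hS.eigenvectorBasis i, v⟫_ℝ ^ 2 := by
  have hsymm : (toLin S).IsSymmetric := Matrix.isSymmetric_toEuclideanLin_iff.2 hS
  have heig i : toLin S (hS.eigenvectorBasis i) = hS.eigenvalues i • hS.eigenvectorBasis i := by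
    ext j
    have := congrFun (hS.mulVec_eigenvectorBasis i) j
    simpa [toLin] using this
  have : v ⬝ᵥ S.mulVec v = ⟪v, toLin S v⟫_ℝ := by
    simp [toLin, PiLp.inner_apply, dotProduct, mul_comm]
  rw [this, ← hS.eigenvectorBasis.sum_inner_mul_inner]
  refine Finset.sum_congr rfl fun i _ => ?_
  rw [← hsymm, heig, inner_smul_left, real_inner_comm, conj_trivial]
  ring

theorem le_maxEigenvalue (hS : S.IsHermitian) (i : Fin p) : hS.eigenvalues i ≤ maxEigenvalue hS :=
  le_ciSup (Set.finite_range _).bddAbove i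

theorem minEigenvalue_le (hS : S.IsHermitian) (i : Fin p) : minEigenvalue hS ≤ hS.eigenvalues i :=
  ciInf_le (Set.finite_range _).bddBelow i

theorem minEigenvalue_pos (hp : 0 < p) (hS : S.PosDef) : 0 < minEigenvalue hS.isHermitian := by
  have : Nonempty (Fin p) := ⟨⟨0, hp⟩⟩
  obtain ⟨i, hi⟩ := exists_eq_ciInf_of_finite (f := hS.isHermitian.eigenvalues)
  rw [minEigenvalue, ← hi]
  exact hS.eigenvalues_pos i

theorem maxEigenvalue_pos (hp : 0 < p) (hS : S.PosDef) : 0 < maxEigenvalue hS.isHermitian :=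
  (hS.eigenvalues_pos ⟨0, hp⟩).trans_le (le_maxEigenvalue _ _)

theorem dotProduct_mulVec_le (hS : S.IsHermitian) (v : EuclideanSpace ℝ (Fin p)) :
    v ⬝ᵥ S.mulVec v ≤ maxEigenvalue hS * ‖v‖ ^ 2 := by
  rw [dotProduct_mulVec_eq_sum hS, ← hS.eigenvectorBasis.sum_sq_inner_right, Finset.mul_sum]
  exact Finset.sum_le_sum fun i _ =>
    mul_le_mul_of_nonneg_right (le_maxEigenvalue hS i) (sq_nonneg _)

/-- A linear change of variables that turns the quadratic form of `S` into the squared norm. -/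
theorem exists_whitening (hS : S.PosDef) :
    ∃ B : EuclideanSpace ℝ (Fin p) →ₗ[ℝ] EuclideanSpace ℝ (Fin p),
      (∀ y, B y ⬝ᵥ S.mulVec (B y) = ‖y‖ ^ 2) ∧
      ∀ v, ∃ y, B y = v ∧ minEigenvalue hS.isHermitian * ‖v‖ ^ 2 ≤ ‖y‖ ^ 2 := by
  set e := hS.isHermitian.eigenvectorBasis
  set μ := hS.isHermitian.eigenvalues
  have hμ i : 0 < μ i := hS.eigenvalues_pos i
  -- The inverse square root of `S`, written in its eigenbasis.
  let B : EuclideanSpace ℝ (Fin p) →ₗ[ℝ] EuclideanSpace ℝ (Fin p) :=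
    ∑ i, (innerₛₗ ℝ (e i)).smulRight ((√(μ i))⁻¹ • e i)
  have hB y i : ⟪e i, B y⟫_ℝ = (√(μ i))⁻¹ * ⟪e i, y⟫_ℝ := by
    simp [B, inner_sum, inner_smul_right, e.inner_eq_ite, mul_comm]
  have hquad y : B y ⬝ᵥ S.mulVec (B y) = ‖y‖ ^ 2 := by
    rw [dotProduct_mulVec_eq_sum hS.isHermitian, ← e.sum_sq_inner_right]
    refine Finset.sum_congr rfl fun i _ => ?_
    rw [hB, mul_pow, inv_pow, Real.sq_sqrt (hμ i).le, mul_inv_cancel_left₀ (hμ i).ne']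
  refine ⟨B, hquad, fun v => ?_⟩
  have hBy : B (∑ i, (√(μ i) * ⟪e i, v⟫_ℝ) • e i) = v := by
    refine e.repr.injective (PiLp.ext fun i => ?_)
    rw [e.repr_apply_apply, e.repr_apply_apply]
    have := (Real.sqrt_pos.2 (hμ i)).ne'
    rw [hB, inner_sum, inv_mul_eq_iff_eq_mul₀ this]
    simp [inner_smul_right, e.inner_eq_ite]
  refine ⟨_, hBy, ?_⟩
  rw [← hquad (∑ i, _), hBy, dotProduct_mulVec_eq_sum hS.isHermitian, ← e.sum_sq_inner_right,
    Finset.mul_sum]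
  exact Finset.sum_le_sum fun i _ =>
    mul_le_mul_of_nonneg_right (minEigenvalue_le hS.isHermitian i) (sq_nonneg _)

end QuadraticForm

/-! ### Tail bounds in the regression model and the good event -/

section Model

open scoped ENNReal NNReal

variable {Ω : Type*} [MeasurableSpace Ω] {P : Measure Ω} {k p n : ℕ}
  {Θstar : Matrix (Fin k) (Fin p) ℝ} {S : Matrix (Fin p) (Fin p) ℝ} {ν : ℝ}
  {X : Fin n → Ω → EuclideanSpace ℝ (Fin p)} {W Z : Fin n → Ω → EuclideanSpace ℝ (Fin k)}

theorem IsRegressionModel.hasLaw_inner_noise (h : IsRegressionModel P Θstar S ν X W Z)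
    (a : Fin n) (u : EuclideanSpace ℝ (Fin k)) :
    HasLaw (fun ω => ⟪u, W a ω⟫_ℝ) (gaussianReal 0 (ν ^ 2 * ‖u‖ ^ 2).toNNReal) P := by
  have hpsd : (ν ^ 2 • (1 : Matrix (Fin k) (Fin k) ℝ)).PosSemidef :=
    Matrix.PosSemidef.one.smul (sq_nonneg ν)
  have := hasLaw_inner_multivariateGaussian hpsd (h.law_noise a) u
  convert this using 3
  rw [EuclideanSpace.real_norm_sq_eq, Matrix.smul_mulVec, Matrix.one_mulVec, dotProduct_smul]
  simp [dotProduct, sq]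

theorem inv_sqrt_one_sub_pow_le_exp {y : ℝ} (hy0 : 0 ≤ y) (hy : y ≤ 1 / 4) :
    (√(1 - y))⁻¹ ^ n ≤ Real.exp (2 / 3 * n * y) := by
  have h1 : Real.exp (-(4 / 3 * y)) ≤ 1 - y := by
    rw [Real.exp_neg, inv_le_comm₀ (Real.exp_pos _) (by linarith)]
    have := Real.add_one_le_exp (4 / 3 * y)
    refine le_trans ?_ this
    rw [inv_le_iff_one_le_mul₀ (by linarith)]
    -- (1 − y)(1 + 4y/3) ≥ 1 holds exactly for 0 ≤ y ≤ 1/4.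
    nlinarith
  have h2 : Real.exp (-(2 / 3 * y)) ≤ √(1 - y) := by
    refine Real.le_sqrt_of_sq_le ?_
    rw [← Real.exp_nat_mul]
    refine le_trans (le_of_eq ?_) h1
    congr 1
    push_cast
    ring
  calc (√(1 - y))⁻¹ ^ n ≤ (Real.exp (-(2 / 3 * y)))⁻¹ ^ n := by gcongr
    _ = Real.exp (2 / 3 * n * y) := by
      rw [← Real.exp_neg, ← Real.exp_nat_mul]
      congr 1
      ring

theorem IsRegressionModel.measure_sum_sq_le (h : IsRegressionModel P Θstar S ν X W Z)
    (hS : S.PosDef) {v : EuclideanSpace ℝ (Fin p)} (hv : v ⬝ᵥ S.mulVec v = 1) :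
    P {ω | ∑ a, ⟪v, X a ω⟫_ℝ ^ 2 ≤ n / 16} ≤ ENNReal.ofReal (Real.exp (-(n / 2))) := by
  have hlaw a : HasLaw (fun ω => ⟪v, X a ω⟫_ℝ) (gaussianReal 0 1) P := by
    simpa [hv] using hasLaw_inner_multivariateGaussian hS.posSemidef (h.law_covariate a) v
  have htail := measure_le_mul_sum_sq_gaussian hlaw
    (h.indep_covariates.comp (fun _ y => ⟪v, y⟫_ℝ) fun _ => by fun_prop) (s := -8)
    (by norm_num) (-(n / 2))
  refine (measure_mono fun ω hω => ?_).trans (htail.trans (ENNReal.ofReal_le_ofReal ?_))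
  · rw [Set.mem_ofPred_eq] at hω ⊢
    linarith
  · have hsqrt : (√(1 - 2 * (-8) * ((1 : ℝ≥0) : ℝ)))⁻¹ ≤ Real.exp (-1) := by
      rw [Real.exp_neg]
      gcongr
      refine Real.le_sqrt_of_sq_le ?_
      have := pow_le_pow_left₀ (Real.exp_pos 1).le Real.exp_one_lt_d9.le 2
      rw [NNReal.coe_one]
      linarith
    calc _ ≤ Real.exp (-(-(n / 2))) * Real.exp (-1) ^ n := by gcongr
      _ = _ := by
        rw [← Real.exp_nat_mul, ← Real.exp_add]
        congr 1
        ring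

theorem IsRegressionModel.measure_le_sum_sq (h : IsRegressionModel P Θstar S ν X W Z)
    (hS : S.PosDef) {v : EuclideanSpace ℝ (Fin p)} (hv : v ⬝ᵥ S.mulVec v = 1) :
    P {ω | 4 * n ≤ ∑ a, ⟪v, X a ω⟫_ℝ ^ 2} ≤ ENNReal.ofReal (Real.exp (-(n / 2))) := by
  have hlaw a : HasLaw (fun ω => ⟪v, X a ω⟫_ℝ) (gaussianReal 0 1) P := by
    simpa [hv] using hasLaw_inner_multivariateGaussian hS.posSemidef (h.law_covariate a) v
  have htail := measure_le_mul_sum_sq_gaussian hlaw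
    (h.indep_covariates.comp (fun _ y => ⟪v, y⟫_ℝ) fun _ => by fun_prop) (s := 1 / 4)
    (by norm_num) n
  refine (measure_mono fun ω hω => ?_).trans (htail.trans (ENNReal.ofReal_le_ofReal ?_))
  · rw [Set.mem_ofPred_eq] at hω ⊢
    linarith
  · have hsqrt : (√(1 - 2 * (1 / 4) * ((1 : ℝ≥0) : ℝ)))⁻¹ ≤ Real.exp (1 / 2) := by
      rw [inv_le_comm₀ (by norm_num) (Real.exp_pos _)]
      refine Real.le_sqrt_of_sq_le ?_
      rw [inv_pow, ← Real.exp_nat_mul, NNReal.coe_one, inv_le_comm₀ (Real.exp_pos _) (by norm_num)]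
      have := Real.exp_one_gt_d9
      norm_num
      linarith
    calc _ ≤ Real.exp (-n) * Real.exp (1 / 2) ^ n := by gcongr
      _ = _ := by
        rw [← Real.exp_nat_mul, ← Real.exp_add]
        congr 1
        ring

theorem measure_biUnion_finset_le_card_mul {ι : Type*} (μ : Measure Ω) (s : Finset ι)
    {A : ι → Set Ω} {c e : ℝ} (he : 0 ≤ e) (hs : (s.card : ℝ) ≤ c)
    (hA : ∀ i ∈ s, μ (A i) ≤ ENNReal.ofReal e) :
    μ (⋃ i ∈ s, A i) ≤ ENNReal.ofReal (c * e) := by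
  refine (measure_biUnion_finset_le s A).trans ((Finset.sum_le_sum hA).trans ?_)
  rw [Finset.sum_const, nsmul_eq_mul, ← ENNReal.ofReal_natCast, ← ENNReal.ofReal_mul (by simp)]
  gcongr

variable [IsProbabilityMeasure P]

theorem measure_sum_mul_gaussian_le {x w : Fin n → Ω → ℝ} {α : ℝ≥0} {m d : ℝ}
    (hx : ∀ a, HasLaw (x a) (gaussianReal 0 α) P)
    (hw : ∀ a, HasLaw (w a) (gaussianReal 0 (ν ^ 2).toNNReal) P)
    (hxind : iIndepFun x P) (hwind : iIndepFun w P)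
    (hind : IndepFun (fun ω a => x a ω) (fun ω a => w a ω) P)
    (hν : 0 < ν) (hm : 0 < m) (hα : α ≤ m) (hd : 0 < d) (hdn : 16 * d < n) :
    P {ω | 5 / 2 * n * (ν * √m * √(d / n)) ≤ ∑ a, x a ω * w a ω} ≤
      ENNReal.ofReal (Real.exp (-(7 / 3) * d)) := by
  have hn : (0 : ℝ) < n := by linarith
  obtain ⟨δ, hδ_def⟩ : ∃ δ, δ = d / n := ⟨_, rfl⟩
  have hδn : d = n * δ := by rw [hδ_def, mul_div_cancel₀ _ hn.ne']
  have hδ : δ ≤ 1 / 16 := by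
    rw [hδ_def, div_le_iff₀ hn]
    linarith
  have hδ0 : 0 < δ := by rw [hδ_def]; positivity
  have hρ := Real.sq_sqrt hδ0.le
  have hmsq := Real.sq_sqrt hm.le
  have hsm : 0 < √m := Real.sqrt_pos.2 hm
  -- With this tilt the threshold becomes 5d, while t²αν² ≤ 4δ ≤ 1/4 keeps the log-moment below
  -- 8d/3; the exponent is 8/3 − 5 = −7/3.
  obtain ⟨t, ht⟩ : ∃ t, t = 2 * √δ / (ν * √m) := ⟨_, rfl⟩
  have ht0 : 0 ≤ t := by rw [ht]; positivity
  have hy : t ^ 2 * α * (ν ^ 2).toNNReal = 4 * δ * (α / m) := by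
    rw [Real.coe_toNNReal _ (sq_nonneg ν), ht, div_pow, mul_pow, mul_pow, hρ, hmsq]
    field_simp
    ring
  have hratio : α / m ≤ 1 := (div_le_one hm).2 hα
  have hyle : 4 * δ * (α / m) ≤ 4 * δ := mul_le_of_le_one_right (by positivity) hratio
  have hlt : t ^ 2 * α * (ν ^ 2).toNNReal < 1 := by
    rw [hy]
    linarith
  have htail := measure_le_sum_mul_gaussian hx hw hxind hwind hind hlt (5 * d)
  refine (measure_mono fun ω hω => ?_).trans (htail.trans (ENNReal.ofReal_le_ofReal ?_))
  · rw [Set.mem_ofPred_eq] at hω ⊢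
    refine le_trans (le_of_eq ?_) (mul_le_mul_of_nonneg_left hω ht0)
    rw [← hδ_def, ht, hδn]
    nth_rewrite 1 [← hρ]
    field_simp
  · rw [hy]
    calc _ ≤ Real.exp (-(5 * d)) * Real.exp (2 / 3 * n * (4 * δ * (α / m))) := by
          gcongr
          exact inv_sqrt_one_sub_pow_le_exp (by positivity) (by linarith)
      _ ≤ _ := by
          rw [← Real.exp_add, Real.exp_le_exp]
          have := mul_le_mul_of_nonneg_left hyle hn.le
          linarith

/-- Tail bound for the noise process at a fixed pair of unit vectors. -/
theorem IsRegressionModel.measure_noise_le (h : IsRegressionModel P Θstar S ν X W Z)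
    (hp : 0 < p) (hkn : 16 * (k + p) < n) (hν : 0 < ν) (hS : S.PosDef)
    {v : EuclideanSpace ℝ (Fin p)} (hv : ‖v‖ = 1) {u : EuclideanSpace ℝ (Fin k)} (hu : ‖u‖ = 1) :
    P {ω | 5 / 2 * n * (ν * √(maxEigenvalue hS.isHermitian) * √(((k : ℝ) + p) / n)) ≤
        ∑ a, ⟪v, X a ω⟫_ℝ * ⟪u, W a ω⟫_ℝ} ≤
      ENNReal.ofReal (Real.exp (-(7 / 3) * (k + p))) := by
  have hm : 0 < maxEigenvalue hS.isHermitian := maxEigenvalue_pos hp hS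
  have hp' : (0 : ℝ) < p := Nat.cast_pos.2 hp
  have hquad : v ⬝ᵥ S.mulVec v ≤ maxEigenvalue hS.isHermitian := by
    simpa [hv] using dotProduct_mulVec_le hS.isHermitian v
  have hlaww a : HasLaw (fun ω => ⟪u, W a ω⟫_ℝ) (gaussianReal 0 (ν ^ 2).toNNReal) P := by
    simpa [hu] using h.hasLaw_inner_noise a u
  have hkn' : 16 * ((k : ℝ) + p) < n := by exact_mod_cast hkn
  have hlawx a : HasLaw (fun ω => ⟪v, X a ω⟫_ℝ) (gaussianReal 0 (v ⬝ᵥ S.mulVec v).toNNReal) P :=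
    hasLaw_inner_multivariateGaussian hS.posSemidef (h.law_covariate a) v
  have hindx : iIndepFun (fun a ω => ⟪v, X a ω⟫_ℝ) P :=
    h.indep_covariates.comp (fun _ y => ⟪v, y⟫_ℝ) fun _ => by fun_prop
  have hindw : iIndepFun (fun a ω => ⟪u, W a ω⟫_ℝ) P :=
    h.indep_noise.comp (fun _ y => ⟪u, y⟫_ℝ) fun _ => by fun_prop
  have hv_meas : Measurable fun (y : Fin n → EuclideanSpace ℝ (Fin p)) a => ⟪v, y a⟫_ℝ := by
    fun_prop
  have hu_meas : Measurable fun (y : Fin n → EuclideanSpace ℝ (Fin k)) a => ⟪u, y a⟫_ℝ := by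
    fun_prop
  have hind := h.indep_covariates_noise.comp hv_meas hu_meas
  have hα : ((v ⬝ᵥ S.mulVec v).toNNReal : ℝ) ≤ maxEigenvalue hS.isHermitian := by
    rw [Real.coe_toNNReal']
    exact max_le hquad hm.le
  exact measure_sum_mul_gaussian_le hlawx hlaww hindx hindw hind hν hm hα (by positivity) hkn'

/-- With high probability the noise is bounded and the design satisfies restricted strong
convexity. -/
theorem IsRegressionModel.exists_good_event (h : IsRegressionModel P Θstar S ν X W Z)
    (hk : 0 < k) (hp : 0 < p) (hkn : 16 * (k + p) < n) (hν : 0 < ν) (hS : S.PosDef) :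
    ∃ A : Set Ω, MeasurableSet A ∧ 1 - 4 * Real.exp (-(1 / 12) * ((k : ℝ) + p)) < P.real A ∧
      ∀ ω ∈ A,
        (∀ v, ‖crossMap (fun a => X a ω) (fun a => W a ω) v‖ ≤
          (10 * ν * √(maxEigenvalue hS.isHermitian) * √(((k : ℝ) + p) / n)) / 2 * ‖v‖) ∧
        ∀ v, n / 64 * minEigenvalue hS.isHermitian * ‖v‖ ^ 2 ≤ ∑ a, ⟪X a ω, v⟫_ℝ ^ 2 := by
  obtain ⟨B, hB, hBsurj⟩ := exists_whitening hS
  obtain ⟨s, hs1, hscard, hsnet⟩ :=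
    exists_sphere_net (E := EuclideanSpace ℝ (Fin p)) (δ := 1 / 4) (by norm_num)
  obtain ⟨t, ht1, htcard, htnet⟩ :=
    exists_sphere_net (E := EuclideanSpace ℝ (Fin k)) (δ := 1 / 4) (by norm_num)
  obtain ⟨r, hr1, hrcard, hrnet⟩ :=
    exists_sphere_net (E := EuclideanSpace ℝ (Fin p)) (δ := 1 / 17) (by norm_num)
  rw [finrank_euclideanSpace_fin] at hscard htcard hrcard
  set b : ℝ := ν * √(maxEigenvalue hS.isHermitian) * √(((k : ℝ) + p) / n) with hb
  have hb0 : 0 ≤ b := by positivity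
  have hp' : (0 : ℝ) < p := Nat.cast_pos.2 hp
  have hk' : (0 : ℝ) < k := Nat.cast_pos.2 hk
  have hkn' : 16 * ((k : ℝ) + p) < n := by exact_mod_cast hkn
  have hn : (0 : ℝ) < n := by linarith
  let bad₁ : Set Ω := ⋃ z ∈ s ×ˢ t,
    {ω | 5 / 2 * n * b ≤ ∑ a, ⟪z.1, X a ω⟫_ℝ * ⟪z.2, W a ω⟫_ℝ}
  let bad₂ : Set Ω := ⋃ c ∈ r, {ω | ∑ a, ⟪B c, X a ω⟫_ℝ ^ 2 ≤ n / 16}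
  let bad₃ : Set Ω := ⋃ c ∈ r, {ω | 4 * n ≤ ∑ a, ⟪B c, X a ω⟫_ℝ ^ 2}
  let bad : Set Ω := bad₁ ∪ (bad₂ ∪ bad₃)
  have hunit c (hc : c ∈ r) : B c ⬝ᵥ S.mulVec (B c) = 1 := by rw [hB, hr1 c hc, one_pow]
  have hbad₁ : P bad₁ ≤ ENNReal.ofReal (Real.exp (-(1 / 12) * (k + p))) := by
    -- The product net has at most 9^(k+p) points, and 9/4 − 7/3 = −1/12 is the final rate.
    have hcard : ((s ×ˢ t).card : ℝ) ≤ Real.exp (9 / 4 * (k + p)) := by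
      have h9 : (9 : ℝ) ≤ Real.exp (9 / 4) := by
        have h4 : (9 : ℝ) ^ 4 ≤ Real.exp (9 / 4) ^ 4 := by
          rw [← Real.exp_nat_mul]
          have : ((4 : ℕ) : ℝ) * (9 / 4) = (9 : ℕ) * 1 := by norm_num
          rw [this, Real.exp_nat_mul]
          calc (9 : ℝ) ^ 4 ≤ 2.7 ^ 9 := by norm_num
            _ ≤ Real.exp 1 ^ 9 := by
              have := Real.exp_one_gt_d9
              gcongr
              linarith
        exact le_of_pow_le_pow_left₀ (by norm_num) (Real.exp_pos _).le h4
      rw [Finset.card_product, Nat.cast_mul]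
      calc (s.card : ℝ) * t.card ≤ 9 ^ p * 9 ^ k := by
            norm_num at hscard htcard
            gcongr
        _ = 9 ^ (p + k) := (pow_add _ _ _).symm
        _ ≤ Real.exp (9 / 4) ^ (p + k) := by gcongr
        _ = _ := by
            rw [← Real.exp_nat_mul]
            congr 1
            push_cast
            ring
    refine (measure_biUnion_finset_le_card_mul P _
      (Real.exp_pos (-(7 / 3) * ((k : ℝ) + p))).le hcard
      fun z hz => ?_).trans (ENNReal.ofReal_le_ofReal (le_of_eq ?_))
    · rw [Finset.mem_product] at hz
      exact h.measure_noise_le hp hkn hν hS (hs1 _ hz.1) (ht1 _ hz.2)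
    · rw [← Real.exp_add]
      congr 1
      ring
  -- A 1/17-net has at most 35^p ≤ e^(4p) points, and 16p < n keeps this below half of the tail
  -- exponent n/2.
  have hrcard' : (r.card : ℝ) ≤ Real.exp (n / 4) := by
    have h35 : (35 : ℝ) ≤ Real.exp 4 := by
      have : (4 : ℝ) = (4 : ℕ) * 1 := by norm_num
      rw [this, Real.exp_nat_mul]
      calc (35 : ℝ) ≤ 2.7 ^ 4 := by norm_num
        _ ≤ Real.exp 1 ^ 4 := by
          have := Real.exp_one_gt_d9
          gcongr
          linarith
    calc (r.card : ℝ) ≤ 35 ^ p := by norm_num at hrcard; exact hrcard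
      _ ≤ Real.exp 4 ^ p := by gcongr
      _ ≤ _ := by
        rw [← Real.exp_nat_mul, Real.exp_le_exp]
        linarith
  have hexp : Real.exp (n / 4) * Real.exp (-(n / 2)) ≤ Real.exp (-(1 / 12) * (k + p)) := by
    rw [← Real.exp_add, Real.exp_le_exp]
    linarith
  have hbad₂ : P bad₂ ≤ ENNReal.ofReal (Real.exp (-(1 / 12) * (k + p))) :=
    (measure_biUnion_finset_le_card_mul P _ (Real.exp_pos _).le hrcard'
      fun c hc => h.measure_sum_sq_le hS (hunit c hc)).trans (ENNReal.ofReal_le_ofReal hexp)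
  have hbad₃ : P bad₃ ≤ ENNReal.ofReal (Real.exp (-(1 / 12) * (k + p))) :=
    (measure_biUnion_finset_le_card_mul P _ (Real.exp_pos _).le hrcard'
      fun c hc => h.measure_le_sum_sq hS (hunit c hc)).trans (ENNReal.ofReal_le_ofReal hexp)
  have hbad : P.real bad ≤ 3 * Real.exp (-(1 / 12) * (k + p)) := by
    refine ENNReal.toReal_le_of_le_ofReal (by positivity) ?_
    refine (measure_union_le _ _).trans ((add_le_add hbad₁ ((measure_union_le _ _).trans
      (add_le_add hbad₂ hbad₃))).trans (le_of_eq ?_))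
    rw [← ENNReal.ofReal_add (by positivity) (by positivity),
      ← ENNReal.ofReal_add (by positivity) (by positivity)]
    congr 1
    ring
  -- The bad set need not be measurable, as the variables are only a.e. measurable. Its measurable
  -- hull has the same probability, at most 3 exponentials; the stated 4 makes the inequality
  -- strict.
  refine ⟨(toMeasurable P bad)ᶜ, (measurableSet_toMeasurable _ _).compl, ?_, fun ω hω => ?_⟩
  · rw [probReal_compl_eq_one_sub (measurableSet_toMeasurable _ _)]
    have : P.real (toMeasurable P bad) = P.real bad := by
      rw [measureReal_def, measure_toMeasurable, measureReal_def]
    rw [this]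
    linarith [Real.exp_pos (-(1 / 12) * ((k : ℝ) + p))]
  have hgood : ω ∉ bad := fun hmem => hω (subset_toMeasurable P bad hmem)
  simp only [bad, bad₁, bad₂, bad₃, Set.mem_union, Set.mem_iUnion, Set.mem_ofPred_eq, not_or,
    not_exists, not_le, exists_prop, not_and] at hgood
  obtain ⟨hg₁, hg₂, hg₃⟩ := hgood
  constructor
  · intro v
    -- The net argument doubles 5b/2 to 5b, which is half of λ = 10b.
    have hbd := norm_le_of_net s t hs1 hsnet htnet
      (crossMap (fun a => X a ω) (fun a => W a ω)) (a := 5 / 2 * b) (by positivity)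
      (fun y hy u hu => ?_) v
    · refine hbd.trans (le_of_eq ?_)
      rw [hb]
      ring
    · have := hg₁ (y, u) (Finset.mem_product.2 ⟨hy, hu⟩)
      rw [crossMap_apply, inner_smul_right, inner_sum, inv_mul_le_iff₀ hn]
      have hcomm a : ⟪X a ω, y⟫_ℝ = ⟪y, X a ω⟫_ℝ := real_inner_comm _ _
      simp_rw [inner_smul_right, hcomm]
      linarith
  · intro v
    obtain ⟨y, rfl, hy⟩ := hBsurj v
    have := sum_inner_sq_ge_of_net (x := fun a => X a ω) B r hrnet
      (fun c hc => (hg₂ c hc).le) (fun c hc => (hg₃ c hc).le) y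
    have hcomm a : ⟪X a ω, B y⟫_ℝ = ⟪B y, X a ω⟫_ℝ := real_inner_comm _ _
    simp_rw [hcomm]
    refine le_trans ?_ this
    rw [mul_assoc]
    gcongr

end Model

end LowRank

theorem corollary3 :
    ∃ c₁ c₂ c₃ : ℝ, 0 < c₁ ∧ 0 < c₂ ∧ 0 < c₃ ∧
      ∀ (k p n : ℕ), 0 < k → 0 < p → 16 * (k + p) < n →
      ∀ (q R ν : ℝ), 0 ≤ q → q ≤ 1 → 0 < R → 0 < ν →
      ∀ (S : Matrix (Fin p) (Fin p) ℝ) (hS : S.PosDef)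
        (Θstar : Matrix (Fin k) (Fin p) ℝ), Θstar ∈ LowRank.schattenBall k p q R →
      ∀ (Ω : Type*) [MeasurableSpace Ω] (P : Measure Ω) [IsProbabilityMeasure P]
        (X : Fin n → Ω → EuclideanSpace ℝ (Fin p))
        (W Z : Fin n → Ω → EuclideanSpace ℝ (Fin k)),
        LowRank.IsRegressionModel P Θstar S ν X W Z →
      ∃ A : Set Ω, MeasurableSet A ∧
        1 - c₂ * Real.exp (-c₃ * ((k : ℝ) + p)) < P.real A ∧
        ∀ ω ∈ A, ∀ Θhat : Matrix (Fin k) (Fin p) ℝ,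
          LowRank.IsSolution (fun a => X a ω) (fun a => Z a ω)
            (10 * ν * √(LowRank.maxEigenvalue hS.isHermitian) * √(((k : ℝ) + p) / n)) Θhat →
          LowRank.frobeniusSq (Θhat - Θstar) ≤
            c₁ * (ν ^ 2 * LowRank.maxEigenvalue hS.isHermitian /
                LowRank.minEigenvalue hS.isHermitian ^ 2) ^ (1 - q / 2) *
              R * (((k : ℝ) + p) / n) ^ (1 - q / 2) := by
  -- 640 = 10 · 64 comes from λ divided by κ = σ_min/64. Its power 2 − q is at most 640², which
  -- makes the constant independent of `q`.
  refine ⟨22 * 640 ^ 2, 4, 1 / 12, by norm_num, by norm_num, by norm_num, ?_⟩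
  intro k p n hk hp hkn q R ν hq0 hq1 hR hν S hS Θstar hstar Ω _ P _ X W Z h
  obtain ⟨A, hA, hPA, hgood⟩ := h.exists_good_event hk hp hkn hν hS
  refine ⟨A, hA, hPA, fun ω hω Θhat hsol => ?_⟩
  obtain ⟨hnoise, hdesign⟩ := hgood ω hω
  have hmin := LowRank.minEigenvalue_pos hp hS
  have hmax := LowRank.maxEigenvalue_pos hp hS
  set m := LowRank.maxEigenvalue hS.isHermitian
  set m' := LowRank.minEigenvalue hS.isHermitian
  have hn : (0 : ℝ) < n := Nat.cast_pos.2 (by omega)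
  have hp' : (0 : ℝ) < p := Nat.cast_pos.2 hp
  have hk' : (0 : ℝ) < k := Nat.cast_pos.2 hk
  set δ := ((k : ℝ) + p) / n
  have hδ : 0 < δ := by positivity
  have hbound := hsol.frobeniusSq_sub_le (κ := m' / 64) hq0 hq1 (by positivity) (by positivity)
    hstar (fun a => h.output_eq a ω) hnoise fun D => by
      have := LowRank.mul_frobeniusSq_le hdesign D
      rw [le_inv_mul_iff₀ hn]
      linarith
  refine hbound.trans ?_
  set x := ν ^ 2 * m / m' ^ 2
  have hx : 0 < x := by positivity
  have hsq : (10 * ν * √m * √δ / (m' / 64)) ^ 2 = 640 ^ 2 * (x * δ) := by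
    rw [div_pow, mul_pow, mul_pow, mul_pow, Real.sq_sqrt hmax.le, Real.sq_sqrt hδ.le]
    simp only [x]
    field_simp
    norm_num
  have hpow : (10 * ν * √m * √δ / (m' / 64)) ^ (2 - q) ≤
      640 ^ 2 * (x ^ (1 - q / 2) * δ ^ (1 - q / 2)) := by
    have : 2 - q = (2 : ℕ) * (1 - q / 2) := by push_cast; ring
    rw [this, Real.rpow_mul (by positivity), Real.rpow_natCast, hsq,
      Real.mul_rpow (by positivity) (by positivity), Real.mul_rpow hx.le hδ.le]
    gcongr
    exact Real.rpow_le_self_of_one_le (by norm_num) (by linarith)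
  calc _ ≤ 22 * R * (640 ^ 2 * (x ^ (1 - q / 2) * δ ^ (1 - q / 2))) := by gcongr
    _ = _ := by ring
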